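/- Let $(X,d)$ be a metric space of bounded geometry, i.e. for every $r>0$ there is $N_r\in\mathbb N$ such that every open ball $B(x,r)$, $x\in X$, has fewer than $N_r$ points. A bounded operator $T$ on $\ell^2(X)$ (complex coefficients, canonical basis $(\delta_x)_{x\in X}$) has finite propagation if there is $S\ge 0$ with $\langle \delta_x,T\delta_y\rangle=0$ whenever $d(x,y)>S$; these operators form a $*$-subalgebra of $\mathcal B(\ell^2(X))$, and the uniform Roe algebra $C^*_u(X)$ is its norm closure. A unital $C^*$-algebra $A$ is nuclear if for every finite $F\subseteq A$ and every $\epsilon>0$ there are $n\in\mathbb{N}$ and unital completely positive maps $\phi:A\to M_n(\mathbb C)$, $\psi:M_n(\mathbb C)\to A$ with $\|a-\psi(\phi(a))\|<\epsilon$ for all $a\in F$ (with $n=0$ allowed, so that the zero algebra is nuclear). The space $X$ has property A if for all $R,\epsilon>0$ there is a family $(A_x)_{x\in X}$ of finite non-empty subsets of $X\times\mathbb N$ such that \begin{itemize} \item for all $x,y\in X$ with $d(x,y)\le R$ one has $A_x\cap A_y\neq\emptyset$ and $\dfrac{|A_x\triangle A_y|}{|A_x\cap A_y|}<\epsilon$;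 \item there is $S$ such that $d(x,y)\le S$ whenever $x\in X$ and $(y,n)\in A_x$. \end{itemize} Then $C^*_u(X)$ is nuclear if and only if $X$ has property A. -/

import Mathlib

/-- Bounded geometry: for every `r > 0` the cardinalities of the open balls of radius `r` are
uniformly bounded. In particular all balls are finite, so the topology is discrete. -/
def HasBoundedGeometry (X : Type*) [MetricSpace X] : Prop :=
  ∀ r : ℝ, 0 < r → ∃ N : ℕ, ∀ x : X, (Metric.ball x r).encard < (N : ℕ∞)

open scoped Classical in
/-- Property A. The condition `(A x ∩ A y).Nonempty` is what it means for the quotient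
`|A x ∆ A y| / |A x ∩ A y|` to be a real number. -/
def HasPropertyA (X : Type*) [MetricSpace X] : Prop :=
  ∀ R ε : ℝ, 0 < R → 0 < ε →
    ∃ A : X → Finset (X × ℕ),
      (∀ x, (A x).Nonempty) ∧
      (∀ x y, dist x y ≤ R →
        (A x ∩ A y).Nonempty ∧
          ((symmDiff (A x) (A y)).card : ℝ) / ((A x ∩ A y).card : ℝ) < ε) ∧
      ∃ S : ℝ, ∀ x, ∀ p ∈ A x, dist x p.1 ≤ S

/-- The complex Hilbert space `ℓ²(X)`. -/
abbrev HilbertL2 (X : Type*) : Type _ := lp (fun _ : X => ℂ) 2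

/-- The bounded operators on `ℓ²(X)`. -/
abbrev BoundedOps (X : Type*) : Type _ := HilbertL2 X →L[ℂ] HilbertL2 X

open scoped Classical in
/-- The matrix entry `⟨δ_x, T δ_y⟩` of a bounded operator on `ℓ²(X)`. With `P_x` the orthogonal
projection onto the span of `δ_x`, the operator `P_x T P_y` vanishes exactly when this entry
does. -/
noncomputable def matrixEntry {X : Type*} (T : BoundedOps X) (x y : X) : ℂ :=
  T (lp.single 2 y (1 : ℂ)) x

/-- `T` has finite propagation: its matrix entries vanish at some distance from the diagonal. -/
def HasFinitePropagation {X : Type*} [MetricSpace X] (T : BoundedOps X) : Prop :=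
  ∃ S : ℝ, 0 ≤ S ∧ ∀ x y : X, S < dist x y → matrixEntry T x y = 0

section Entries

variable {X : Type*}

open scoped Classical in
theorem matrixEntry_eq_inner (T : BoundedOps X) (x y : X) :
    matrixEntry T x y =
      inner ℂ (lp.single 2 x (1 : ℂ) : HilbertL2 X) (T (lp.single 2 y (1 : ℂ))) := by
  simp [matrixEntry, lp.inner_single_left]

theorem matrixEntry_star (T : BoundedOps X) (x y : X) :
    matrixEntry (star T) x y = star (matrixEntry T y x) := by
  classical
  rw [matrixEntry_eq_inner, matrixEntry_eq_inner, ContinuousLinearMap.star_eq_adjoint,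
    ContinuousLinearMap.adjoint_inner_right, ← inner_conj_symm]
  rfl

theorem matrixEntry_mul_hasSum (T U : BoundedOps X) (x z : X) :
    HasSum (fun y => matrixEntry U y z * matrixEntry T x y) (matrixEntry (T * U) x z) := by
  classical
  have h := lp.hasSum_single (E := fun _ : X => ℂ) (p := 2) (by simp)
    (U (lp.single 2 z (1 : ℂ)))
  have h2 := (h.mapL T).mapL
    (innerSL ℂ (lp.single 2 x (1 : ℂ) : HilbertL2 X))
  have hval : innerSL ℂ (lp.single 2 x (1 : ℂ) : HilbertL2 X) (T (U (lp.single 2 z (1 : ℂ))))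
      = matrixEntry (T * U) x z := by
    rw [innerSL_apply_apply, matrixEntry_eq_inner]
    rfl
  rw [hval] at h2
  suffices hf : (fun y => matrixEntry U y z * matrixEntry T x y) = fun y =>
      innerSL ℂ (lp.single 2 x (1 : ℂ) : HilbertL2 X)
        (T (lp.single 2 y (U (lp.single 2 z (1 : ℂ)) y))) by
    rw [hf]; exact h2
  funext y
  have : (lp.single 2 y (U (lp.single 2 z (1 : ℂ)) y) : HilbertL2 X)
      = (U (lp.single 2 z (1 : ℂ)) y) • (lp.single 2 y (1 : ℂ) : HilbertL2 X) := by
    rw [← lp.single_smul]; simp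
  rw [this, map_smul, map_smul, innerSL_apply_apply, ← matrixEntry_eq_inner]
  rfl

theorem matrixEntry_algebraMap_of_ne (c : ℂ) {x y : X} (h : x ≠ y) :
    matrixEntry (algebraMap ℂ (BoundedOps X) c) x y = 0 := by
  classical
  simp [matrixEntry, Algebra.algebraMap_eq_smul_one, h]

end Entries

/-- The `*`-algebra of finite propagation operators on `ℓ²(X)`. -/
noncomputable def finitePropagationAlgebra (X : Type*) [MetricSpace X] : StarSubalgebra ℂ (BoundedOps X) where
  carrier := {T | HasFinitePropagation T}
  mul_mem' := by
    rintro T U ⟨S, hS, hT⟩ ⟨S', hS', hU⟩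
    refine ⟨S + S', by positivity, fun x z hxz => ?_⟩
    refine (matrixEntry_mul_hasSum T U x z).unique ?_
    convert hasSum_zero using 2 with y
    by_cases hy : S < dist x y
    · rw [hT x y hy, mul_zero]
    · rw [hU y z (by linarith [dist_triangle x y z]), zero_mul]
  add_mem' := by
    rintro T U ⟨S, hS, hT⟩ ⟨S', hS', hU⟩
    refine ⟨max S S', le_max_of_le_left hS, fun x y hxy => ?_⟩
    have h1 := hT x y ((le_max_left _ _).trans_lt hxy)
    have h2 := hU x y ((le_max_right _ _).trans_lt hxy)
    simp only [matrixEntry] at h1 h2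
    simp [matrixEntry, h1, h2]
  algebraMap_mem' c :=
    ⟨0, le_rfl, fun _ _ hxy => matrixEntry_algebraMap_of_ne c (dist_pos.mp hxy)⟩
  star_mem' := by
    rintro T ⟨S, hS, hT⟩
    refine ⟨S, hS, fun x y hxy => ?_⟩
    rw [matrixEntry_star, hT y x (by rwa [dist_comm]), star_zero]

/-- The uniform Roe algebra: the norm closure of the finite propagation operators in the bounded
operators on `ℓ²(X)`. -/
noncomputable def uniformRoeAlgebra (X : Type*) [MetricSpace X] : StarSubalgebra ℂ (BoundedOps X) :=
  (finitePropagationAlgebra X).topologicalClosure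

noncomputable instance uniformRoeAlgebra.instCStarAlgebra (X : Type*) [MetricSpace X] :
    CStarAlgebra (uniformRoeAlgebra X) :=
  StarSubalgebra.cstarAlgebra (uniformRoeAlgebra X)
    (h_closed := (finitePropagationAlgebra X).isClosed_topologicalClosure)

/-- The order of operators, restricted to the uniform Roe algebra, is the order of the uniform Roe
algebra as a C⋆-algebra. -/
instance uniformRoeAlgebra.instStarOrderedRing (X : Type*) [MetricSpace X] :
    StarOrderedRing (uniformRoeAlgebra X) := by
  have hcl : IsClosed ((uniformRoeAlgebra X : StarSubalgebra ℂ (BoundedOps X)) :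
      Set (BoundedOps X)) := (finitePropagationAlgebra X).isClosed_topologicalClosure
  refine StarOrderedRing.of_nonneg_iff' (fun {x y} h z => ?_) (fun x => ⟨fun hx => ?_, ?_⟩)
  · exact add_le_add_right (show (x : BoundedOps X) ≤ y from h) (z : BoundedOps X)
  · have hx' : (0 : BoundedOps X) ≤ (x : BoundedOps X) := hx
    have hsa : IsSelfAdjoint x := Subtype.ext (IsSelfAdjoint.of_nonneg hx')
    have hspec : spectrum ℝ x = spectrum ℝ (x : BoundedOps X) := by
      rw [← spectrum.preimage_algebraMap (R := ℝ) ℂ (a := x),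
        ← spectrum.preimage_algebraMap (R := ℝ) ℂ (a := (x : BoundedOps X)),
        StarSubalgebra.spectrum_eq (hS := hcl)]
    have hq : QuasispectrumRestricts x ContinuousMap.realToNNReal := by
      rw [quasispectrumRestricts_iff_spectrumRestricts, SpectrumRestricts.nnreal_iff, hspec]
      exact fun r hr => spectrum_nonneg_of_nonneg hx' hr
    obtain ⟨s, hs, -, hss⟩ :=
      CFC.exists_sqrt_of_isSelfAdjoint_of_quasispectrumRestricts hsa hq
    exact ⟨s, by rw [hs.star_eq, hss]⟩
  · rintro ⟨s, rfl⟩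
    exact star_mul_self_nonneg (s : BoundedOps X)

open scoped ComplexOrder in
/-- A linear map of unital C⋆-algebras is nuclear if it is approximated on finite sets by
compositions of unital completely positive maps through full matrix algebras `M_n(ℂ)`.
(The value `n = 0` can only occur if `B` is the zero algebra.) -/
def IsNuclearMap {A B : Type*} [CStarAlgebra A] [PartialOrder A] [StarOrderedRing A]
    [CStarAlgebra B] [PartialOrder B] [StarOrderedRing B] (θ : A →ₗ[ℂ] B) : Prop :=
  ∀ (F : Finset A) (ε : ℝ), 0 < ε →
    ∃ (n : ℕ) (φ : CompletelyPositiveMap A (CStarMatrix (Fin n) (Fin n) ℂ))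
      (ψ : CompletelyPositiveMap (CStarMatrix (Fin n) (Fin n) ℂ) B),
      φ 1 = 1 ∧ ψ 1 = 1 ∧ ∀ a ∈ F, ‖θ a - ψ (φ a)‖ < ε

/-- A unital C⋆-algebra is nuclear if its identity map is nuclear. The order on `A` is the usual
one of a C⋆-algebra, since `StarOrderedRing A` determines it. -/
def IsNuclearCStarAlgebra (A : Type*) [CStarAlgebra A] [PartialOrder A] [StarOrderedRing A] :
    Prop :=
  IsNuclearMap (LinearMap.id : A →ₗ[ℂ] A)

/-! Property A gives nuclearity. The unit vectors `ξ_x = |A x|^(-1/2) 1_{A x}` satisfy `⟨ξ_x, ξ_y⟩ ≈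
1` for `dist x y ≤ R`, so Schur multiplication by this kernel barely moves operators of propagation
`R`. This multiplier factors through completely positive maps: cut an operator down to the balls of
radius `S`, then glue the blocks with weights (`exists_gluing`). There may be infinitely many balls,
but by bounded geometry a finite set of operators shows only finitely many blocks up to `δ`
(`HasBoundedGeometry.exists_ball_types`). One representative block per type suffices, and these
blocks fit into a single `M_n(ℂ)`. The error is estimated in `norm_sub_gluing_compression_le`.

Nuclearity gives property A. By Choi's theorem `ψ M = ∑ M i j • (star (b k i) * b k j)`, and the `b
k i` may be perturbed to have finite propagation. The weights `g_x(z) = ∑ |b k i (z, x)|²` are then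
supported in balls of a fixed radius and have mass close to `1`. For a partial translation `v` with
entry `1` at `(x, y)`, the entry of `ψ (φ v)` there is close to `1`. By Cauchy–Schwarz and `‖φ v‖ ≤
1` it is also at most about `∑ √g_x √g_y`. Hence `√g_x` and `√g_y` are almost parallel, `g_x` and
`g_y` are close in `ℓ¹`, and rounding them to integers yields the sets (`hasPropertyA_of_l1`).
Finitely many partial translations reach all pairs with `dist x y ≤ R`. -/

section CompletelyPositive

open scoped CStarAlgebra InnerProductSpace

/-! ### Positivity of operator matrices via faithful representations -/

section Representation

variable {B H : Type*} [CStarAlgebra B]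
  [NormedAddCommGroup H] [InnerProductSpace ℂ H] [CompleteSpace H]

/-- The amplification of a representation of `B` on `H` to a representation of `M_k(B)` on `H^k`. -/
noncomputable def CStarMatrix.amplify {k : Type*} [Fintype k] [DecidableEq k]
    (ρ : B →⋆ₐ[ℂ] (H →L[ℂ] H)) :
    CStarMatrix k k B →⋆ₐ[ℂ] (PiLp 2 (fun _ : k => H) →L[ℂ] PiLp 2 (fun _ : k => H)) where
  toFun M :=
    { toFun := fun v => WithLp.toLp 2 fun i => ∑ j, ρ (M i j) (v j)
      map_add' := fun v w => by
        ext i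
        simp [Finset.sum_add_distrib]
      map_smul' := fun c v => by
        ext i
        simp [Finset.smul_sum]
      cont := by fun_prop }
  map_one' := by
    ext v i
    simp [CStarMatrix.one_apply, apply_ite ρ, ite_apply, apply_ite DFunLike.coe]
  map_mul' M N := by
    ext v i
    simp only [ContinuousLinearMap.coe_mk', LinearMap.coe_mk, AddHom.coe_mk,
      mul_apply_eq_comp, CStarMatrix.mul_apply, map_sum, map_mul,
      sum_apply]
    rw [Finset.sum_comm]
  map_zero' := by
    ext v i
    simp
  map_add' M N := by
    ext v i
    simp [Finset.sum_add_distrib]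
  commutes' c := by
    ext v i
    simp [CStarMatrix.algebraMap_apply, apply_ite ρ, ite_apply, apply_ite DFunLike.coe,
      Algebra.algebraMap_eq_smul_one]
  map_star' M := by
    rw [ContinuousLinearMap.star_eq_adjoint, ContinuousLinearMap.eq_adjoint_iff]
    intro v w
    simp only [PiLp.inner_apply, ContinuousLinearMap.coe_mk', LinearMap.coe_mk, AddHom.coe_mk,
      sum_inner, inner_sum, CStarMatrix.star_apply, map_star,
      ContinuousLinearMap.star_eq_adjoint, ContinuousLinearMap.adjoint_inner_left]
    rw [Finset.sum_comm]

theorem CStarMatrix.amplify_apply {k : Type*} [Fintype k] [DecidableEq k]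
    (ρ : B →⋆ₐ[ℂ] (H →L[ℂ] H)) (M : CStarMatrix k k B) (v : PiLp 2 (fun _ : k => H)) (i : k) :
    CStarMatrix.amplify ρ M v i = ∑ j, ρ (M i j) (v j) := rfl

theorem CStarMatrix.amplify_injective {k : Type*} [Fintype k] [DecidableEq k]
    {ρ : B →⋆ₐ[ℂ] (H →L[ℂ] H)} (hρ : Function.Injective ρ) :
    Function.Injective (CStarMatrix.amplify (k := k) ρ) := by
  rw [injective_iff_map_eq_zero]
  intro M hM
  ext i j
  apply hρ
  ext v
  have h := congrArg (fun w : PiLp 2 (fun _ : k => H) => w i)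
    (DFunLike.congr_fun hM (PiLp.single 2 j v))
  simp only [CStarMatrix.amplify_apply] at h
  rw [Finset.sum_eq_single j (by intro b _ hb; simp [hb]) (by simp)] at h
  simpa using h

theorem exists_eq_star_mul_self_of_nonneg {C : Type*} [NonUnitalCStarAlgebra C] [PartialOrder C]
    [StarOrderedRing C] {a : C} (ha : 0 ≤ a) : ∃ b : C, a = star b * b :=
  CStarAlgebra.nonneg_iff_eq_star_mul_self.1 ha

/-- An injective `*`-homomorphism reflects positivity. -/
theorem nonneg_of_map_nonneg {C D : Type*} [CStarAlgebra C] [PartialOrder C] [StarOrderedRing C]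
    [CStarAlgebra D] [PartialOrder D] [StarOrderedRing D] (π : C →⋆ₐ[ℂ] D)
    (hπ : Function.Injective π) {a : C} (ha : 0 ≤ π a) : 0 ≤ a := by
  have hsa : IsSelfAdjoint a := hπ (by rw [map_star]; exact (IsSelfAdjoint.of_nonneg ha).star_eq)
  have hc : Continuous π := (NonUnitalStarAlgHom.isometry π hπ).continuous
  -- Functional calculus commutes with `π`, so `π` sends the negative part of `a` to that of `π a`,
  -- which is zero.
  rw [← CFC.negPart_eq_zero_iff a hsa]
  apply hπ
  have h1 := (CFC.negPart_eq_zero_iff (π a) (IsSelfAdjoint.of_nonneg ha)).2 ha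
  rw [map_zero, ← h1, CFC.negPart_def, CFC.negPart_def]
  exact NonUnitalStarAlgHomClass.map_cfcₙ (R := ℝ) (S := ℂ) π (·⁻ : ℝ → ℝ) a
    (hf := by fun_prop) (hf₀ := by simp) (hφ := hc) (ha := hsa) (hφa := IsSelfAdjoint.of_nonneg ha)

theorem CStarMatrix.nonneg_of_inner_nonneg [PartialOrder B] [StarOrderedRing B]
    {k : Type*} [Fintype k] [DecidableEq k]
    {ρ : B →⋆ₐ[ℂ] (H →L[ℂ] H)} (hρ : Function.Injective ρ) {M : CStarMatrix k k B}
    (h : ∀ v : k → H, ∃ r : ℝ, 0 ≤ r ∧ ∑ i, ∑ j, ⟪v i, ρ (M i j) (v j)⟫_ℂ = r) : 0 ≤ M := by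
  apply nonneg_of_map_nonneg (CStarMatrix.amplify ρ) (CStarMatrix.amplify_injective hρ)
  rw [ContinuousLinearMap.nonneg_iff_isPositive, ContinuousLinearMap.isPositive_iff_complex]
  intro v
  obtain ⟨r, hr, hv⟩ := h v
  have h1 : ⟪CStarMatrix.amplify ρ M v, v⟫_ℂ = r := by
    rw [← inner_conj_symm, PiLp.inner_apply]
    simp only [CStarMatrix.amplify_apply, inner_sum]
    rw [hv]
    simp
  rw [h1]
  simpa using hr

end Representation

/-! ### Completely positive maps -/

variable {A B : Type*} [CStarAlgebra A] [PartialOrder A] [StarOrderedRing A]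
  [CStarAlgebra B] [PartialOrder B] [StarOrderedRing B]

/-- A linear map is completely positive if its composition with a faithful representation is
of positive type. -/
noncomputable def CompletelyPositiveMap.ofPositiveType {H : Type*} [NormedAddCommGroup H]
    [InnerProductSpace ℂ H] [CompleteSpace H] (ρ : B →⋆ₐ[ℂ] (H →L[ℂ] H))
    (hρ : Function.Injective ρ) (θ : A →ₗ[ℂ] B)
    (h : ∀ (k : ℕ) (a : Fin k → A) (v : Fin k → H), ∃ r : ℝ, 0 ≤ r ∧
      ∑ i, ∑ j, ⟪v i, ρ (θ (star (a i) * a j)) (v j)⟫_ℂ = r) :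
    CompletelyPositiveMap A B :=
  { θ with
    map_cstarMatrix_nonneg' := fun k M hM => by
      obtain ⟨N, rfl⟩ := exists_eq_star_mul_self_of_nonneg hM
      refine CStarMatrix.nonneg_of_inner_nonneg hρ fun v => ?_
      -- Each row `l` of `N` contributes one form of positive type to `star N * N`.
      choose r hr hrv using fun l => h k (fun i => N l i) v
      refine ⟨∑ l, r l, Finset.sum_nonneg fun l _ => hr l, ?_⟩
      push_cast
      simp only [← hrv]
      rw [← Finset.sum_comm_cycle]
      simp [CStarMatrix.mul_apply, CStarMatrix.star_apply] }

theorem CStarMatrix.diag_nonneg {k : Type*} [Fintype k] [DecidableEq k]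
    {M : CStarMatrix k k B} (hM : 0 ≤ M) (i : k) : 0 ≤ M i i := by
  obtain ⟨N, rfl⟩ := exists_eq_star_mul_self_of_nonneg hM
  rw [CStarMatrix.mul_apply]
  exact Finset.sum_nonneg fun l _ => by
    rw [CStarMatrix.star_apply]; exact star_mul_self_nonneg _

/-- Kadison's inequality for unital completely positive maps. -/
theorem CompletelyPositiveMap.star_mul_map_le (φ : CompletelyPositiveMap A B) (h1 : φ 1 = 1)
    (a : A) : star (φ a) * φ a ≤ φ (star a * a) := by
  -- Here `star N * N` is `[[1, a], [a*, a* a]]`. Compressing its image under `φ` by the column `(-φ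
  -- a, 1)` of `D` leaves `φ (a* a) - (φ a)* φ a`.
  let N : CStarMatrix (Fin 2) (Fin 2) A := CStarMatrix.ofMatrix !![1, a; 0, 0]
  let D : CStarMatrix (Fin 2) (Fin 2) B := CStarMatrix.ofMatrix !![-φ a, 0; 1, 0]
  have hM := φ.map_cstarMatrix_nonneg' 2 (star N * N) (star_mul_self_nonneg N)
  have hD := CStarMatrix.diag_nonneg (star_left_conjugate_nonneg hM D) 0
  have e : (star D * (star N * N).map φ.toLinearMap * D) 0 0
      = φ (star a * a) - star (φ a) * φ a := by
    have e1 : φ.toLinearMap 1 = 1 := h1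
    have e2 : φ.toLinearMap a = φ a := rfl
    have e3 : φ.toLinearMap (star a * a) = φ (star a * a) := rfl
    -- Positive matrices are self-adjoint; comparing off-diagonal entries shows that `φ` preserves
    -- adjoints.
    have e4 : φ.toLinearMap (star a) = star (φ a) := by
      have := CStarMatrix.star_apply_of_isSelfAdjoint (IsSelfAdjoint.of_nonneg hM) (i := 0) (j := 1)
      simpa [CStarMatrix.mul_apply, CStarMatrix.star_apply, N, e2] using this.symm
    simp [CStarMatrix.mul_apply, CStarMatrix.star_apply, Fin.sum_univ_two, N, D, e1, e2, e3, e4]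
    abel
  rw [e] at hD
  exact sub_nonneg.1 hD

theorem CompletelyPositiveMap.norm_apply_le (φ : CompletelyPositiveMap A B) (h1 : φ 1 = 1)
    (a : A) : ‖φ a‖ ≤ ‖a‖ := by
  have h2 : φ (star a * a) ≤ ((‖a‖ ^ 2 : ℝ) : ℂ) • 1 := by
    rw [← h1, ← map_smul]
    refine OrderHomClass.mono φ ?_
    have h3 := CStarAlgebra.star_mul_le_algebraMap_norm_sq (a := a)
    rwa [Algebra.algebraMap_eq_smul_one, ← Complex.coe_smul] at h3
  have h3 := CStarAlgebra.norm_le_norm_of_nonneg_of_le (star_mul_self_nonneg (φ a))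
    ((φ.star_mul_map_le h1 a).trans h2)
  rw [CStarRing.norm_star_mul_self, norm_smul] at h3
  have h4 : ‖(1 : B)‖ ≤ 1 := by
    nontriviality B
    rw [CStarRing.norm_one]
  have h5 : ‖φ a‖ * ‖φ a‖ ≤ ‖a‖ ^ 2 := by
    refine h3.trans ?_
    rw [Complex.norm_real, norm_pow, norm_norm]
    exact mul_le_of_le_one_right (by positivity) h4
  exact abs_le_of_sq_le_sq' (by rwa [sq (‖φ a‖)]) (norm_nonneg a) |>.2

end CompletelyPositive

/-! ### Operators on `ℓ²(X)` and their matrices -/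

section Operators

open scoped InnerProductSpace

variable {X : Type*}

open scoped Classical in
/-- The canonical basis vector `δ_x` of `ℓ²(X)`. -/
noncomputable def basisVec (x : X) : HilbertL2 X := lp.single 2 x (1 : ℂ)

theorem norm_basisVec (x : X) : ‖basisVec x‖ = 1 := by
  classical
  simp [basisVec]

theorem apply_basisVec (T : BoundedOps X) (x y : X) : T (basisVec y) x = matrixEntry T x y := rfl

theorem inner_basisVec_left (x : X) (f : HilbertL2 X) : ⟪basisVec x, f⟫_ℂ = f x := by
  classical
  simp [basisVec, lp.inner_single_left]

theorem hasSum_smul_basisVec (f : HilbertL2 X) : HasSum (fun x => f x • basisVec x) f := by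
  classical
  convert lp.hasSum_single (E := fun _ : X => ℂ) (p := 2) (by simp) f using 2 with x
  rw [basisVec, ← lp.single_smul]
  simp

theorem norm_apply_sq_hasSum (f : HilbertL2 X) : HasSum (fun x => ‖f x‖ ^ 2) (‖f‖ ^ 2) := by
  simpa using lp.hasSum_norm (E := fun _ : X => ℂ) (p := 2) (by simp) f

theorem matrixEntry_add (T U : BoundedOps X) (x y : X) :
    matrixEntry (T + U) x y = matrixEntry T x y + matrixEntry U x y := by
  simp [matrixEntry]

theorem matrixEntry_sub (T U : BoundedOps X) (x y : X) :
    matrixEntry (T - U) x y = matrixEntry T x y - matrixEntry U x y := by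
  simp [matrixEntry]

theorem matrixEntry_smul (c : ℂ) (T : BoundedOps X) (x y : X) :
    matrixEntry (c • T) x y = c * matrixEntry T x y := by
  simp [matrixEntry]

open scoped Classical in
theorem matrixEntry_one (x y : X) :
    matrixEntry (1 : BoundedOps X) x y = if x = y then 1 else 0 := by
  simp [matrixEntry, Pi.single_apply]

theorem norm_matrixEntry_le (T : BoundedOps X) (x y : X) : ‖matrixEntry T x y‖ ≤ ‖T‖ := by
  rw [← apply_basisVec]
  calc ‖T (basisVec y) x‖ ≤ ‖T (basisVec y)‖ := lp.norm_apply_le_norm (by simp) _ _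
    _ ≤ ‖T‖ * ‖basisVec y‖ := T.le_opNorm _
    _ = ‖T‖ := by rw [norm_basisVec, mul_one]

theorem matrixEntry_ext {T U : BoundedOps X} (h : ∀ x y, matrixEntry T x y = matrixEntry U x y) :
    T = U := by
  ext1 f
  have hf := hasSum_smul_basisVec f
  refine (hf.mapL T).unique ?_
  convert hf.mapL U using 2 with y
  rw [map_smul, map_smul]
  congr 1
  ext x
  exact h x y

theorem matrixEntry_star_mul (T U : BoundedOps X) (x y : X) :
    matrixEntry (star T * U) x y = ⟪T (basisVec x), U (basisVec y)⟫_ℂ := by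
  rw [matrixEntry_eq_inner, ContinuousLinearMap.star_eq_adjoint, mul_apply_eq_comp,
    ContinuousLinearMap.adjoint_inner_right]
  rfl

/-- The Schur test for matrices with boundedly many non-zero entries in each row and column. -/
theorem exists_operator_of_matrix (m : X → X → ℂ) (N : ℕ) (c : ℝ) (hc : 0 ≤ c)
    (hm : ∀ x y, ‖m x y‖ ≤ c)
    (hrow : ∀ x, ∃ s : Finset X, s.card ≤ N ∧ ∀ y, m x y ≠ 0 → y ∈ s)
    (hcol : ∀ y, ∃ s : Finset X, s.card ≤ N ∧ ∀ x, m x y ≠ 0 → x ∈ s) :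
    ∃ T : BoundedOps X, ‖T‖ ≤ c * N ∧ ∀ x y, matrixEntry T x y = m x y := by
  classical
  have hrow' : ∀ x, ∃ s : Finset X, s.card ≤ N ∧ ∀ y, y ∈ s ↔ m x y ≠ 0 := fun x => by
    obtain ⟨s, hs, h⟩ := hrow x
    exact ⟨s.filter fun y => m x y ≠ 0, (Finset.card_filter_le _ _).trans hs, fun y => by
      simpa using h y⟩
  choose r hr hmr using hrow'
  choose q hq hmq using hcol
  have bound : ∀ (f : HilbertL2 X) (s : Finset X),
      ∑ x ∈ s, ‖∑ y ∈ r x, m x y * f y‖ ^ 2 ≤ (c * N * ‖f‖) ^ 2 := by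
    intro f s
    have h1 : ∀ x, ‖∑ y ∈ r x, m x y * f y‖ ^ 2 ≤ c ^ 2 * N * ∑ y ∈ r x, ‖f y‖ ^ 2 := fun x => by
      have h2 : ‖∑ y ∈ r x, m x y * f y‖ ≤ ∑ y ∈ r x, c * ‖f y‖ := by
        refine (norm_sum_le _ _).trans (Finset.sum_le_sum fun y _ => ?_)
        rw [norm_mul]
        gcongr
        exact hm x y
      calc ‖∑ y ∈ r x, m x y * f y‖ ^ 2 ≤ (∑ y ∈ r x, c * ‖f y‖) ^ 2 := by gcongr
        _ ≤ (r x).card * ∑ y ∈ r x, (c * ‖f y‖) ^ 2 := sq_sum_le_card_mul_sum_sq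
        _ ≤ N * ∑ y ∈ r x, (c * ‖f y‖) ^ 2 := by
          gcongr
          exact hr x
        _ = c ^ 2 * N * ∑ y ∈ r x, ‖f y‖ ^ 2 := by
          simp only [mul_pow, ← Finset.mul_sum]; ring
    -- After interchanging the sums, the column bound says that each `y` is counted at most `N`
    -- times.
    have h3 : ∑ x ∈ s, ∑ y ∈ r x, ‖f y‖ ^ 2 ≤ N * ‖f‖ ^ 2 := by
      rw [Finset.sum_comm' (s' := fun y => s.filter fun x => y ∈ r x) (t' := s.biUnion r)
        (by intro x y; simp only [Finset.mem_filter, Finset.mem_biUnion]; tauto)]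
      calc ∑ y ∈ s.biUnion r, ∑ _x ∈ s.filter fun x => y ∈ r x, ‖f y‖ ^ 2
          ≤ ∑ y ∈ s.biUnion r, N * ‖f y‖ ^ 2 := by
            refine Finset.sum_le_sum fun y _ => ?_
            rw [Finset.sum_const, nsmul_eq_mul]
            gcongr
            refine le_trans (Finset.card_le_card fun x hx => ?_) (hq y)
            exact hmq y x ((hmr x y).1 (Finset.mem_filter.1 hx).2)
        _ ≤ N * ‖f‖ ^ 2 := by
            rw [← Finset.mul_sum]
            gcongr
            exact sum_le_hasSum _ (fun _ _ => by positivity) (norm_apply_sq_hasSum f)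
    calc ∑ x ∈ s, ‖∑ y ∈ r x, m x y * f y‖ ^ 2
        ≤ ∑ x ∈ s, c ^ 2 * N * ∑ y ∈ r x, ‖f y‖ ^ 2 := Finset.sum_le_sum fun x _ => h1 x
      _ = c ^ 2 * N * ∑ x ∈ s, ∑ y ∈ r x, ‖f y‖ ^ 2 := by rw [Finset.mul_sum]
      _ ≤ c ^ 2 * N * (N * ‖f‖ ^ 2) := by gcongr
      _ = (c * N * ‖f‖) ^ 2 := by ring
  have hmem : ∀ f : HilbertL2 X, Memℓp (fun x => ∑ y ∈ r x, m x y * f y) 2 := fun f =>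
    memℓp_gen' (C := (c * N * ‖f‖) ^ 2) fun s => by simpa using bound f s
  let L : HilbertL2 X →ₗ[ℂ] HilbertL2 X :=
    { toFun := fun f => ⟨fun x => ∑ y ∈ r x, m x y * f y, hmem f⟩
      map_add' := fun f g => by
        ext x
        simp only [lp.coeFn_add, Pi.add_apply, mul_add, Finset.sum_add_distrib]
      map_smul' := fun a f => by
        ext x
        simp only [RingHom.id_apply, lp.coeFn_smul, Pi.smul_apply, smul_eq_mul, Finset.mul_sum]
        exact Finset.sum_congr rfl fun y _ => by ring }
  refine ⟨L.mkContinuous (c * N) fun f => ?_, L.mkContinuous_norm_le (by positivity) _,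
    fun x y => ?_⟩
  · refine lp.norm_le_of_forall_sum_le (by simp) (by positivity) fun s => ?_
    simpa [L] using bound f s
  · change ∑ y' ∈ r x, m x y' * basisVec y y' = m x y
    by_cases hy : y ∈ r x
    · rw [Finset.sum_eq_single y (fun b _ hb => by simp [basisVec, hb]) (fun h => absurd hy h)]
      simp [basisVec]
    · rw [Finset.sum_eq_zero fun b hb => ?_]
      · exact (not_not.1 (mt (hmr x y).2 hy)).symm
      · have : b ≠ y := fun h => hy (h ▸ hb)
        simp [basisVec, this]

/-- The closed balls of a space of bounded geometry are uniformly finite. -/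
theorem HasBoundedGeometry.exists_closedBall_finset [MetricSpace X] (hX : HasBoundedGeometry X)
    (P : ℝ) : ∃ N : ℕ, ∀ x : X, ∃ s : Finset X, s.card ≤ N ∧ ∀ y, y ∈ s ↔ dist x y ≤ P := by
  obtain ⟨N, hN⟩ := hX (max P 0 + 1) (by positivity)
  refine ⟨N, fun x => ?_⟩
  have hle : (Metric.closedBall x P).encard ≤ N :=
    (Set.encard_le_encard (Metric.closedBall_subset_ball (by linarith [le_max_left P 0]))).trans
      (hN x).le
  have hfin : (Metric.closedBall x P).Finite := Set.finite_of_encard_le_coe hle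
  refine ⟨hfin.toFinset, ?_, fun y => ?_⟩
  · rw [hfin.encard_eq_coe_toFinset_card] at hle
    exact_mod_cast hle
  · simp [dist_comm]

/-- In a space of bounded geometry, a bounded matrix of finite propagation is the matrix of a
bounded operator, whose norm is controlled by the propagation and the entries. -/
theorem HasBoundedGeometry.exists_operator [MetricSpace X] (hX : HasBoundedGeometry X) (P : ℝ) :
    ∃ N : ℕ, ∀ (c : ℝ) (m : X → X → ℂ), 0 ≤ c → (∀ x y, ‖m x y‖ ≤ c) →
      (∀ x y, P < dist x y → m x y = 0) →
      ∃ T : BoundedOps X, ‖T‖ ≤ c * N ∧ ∀ x y, matrixEntry T x y = m x y := by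
  obtain ⟨N, hN⟩ := hX.exists_closedBall_finset P
  refine ⟨N, fun c m hc hm hP => exists_operator_of_matrix m N c hc hm (fun x => ?_) fun y => ?_⟩
  · obtain ⟨s, hs, h⟩ := hN x
    exact ⟨s, hs, fun y hy => (h y).2 (not_lt.1 fun hlt => hy (hP x y hlt))⟩
  · obtain ⟨s, hs, h⟩ := hN y
    exact ⟨s, hs, fun x hx => (h x).2 (not_lt.1 fun hlt => hx (hP x y (by rwa [dist_comm])))⟩

end Operators

/-! ### Finitely many types of balls -/

section BallTypes

/-- A bounded set of complex numbers can be partitioned into finitely many sets of small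
diameter. -/
theorem exists_finite_rounding (K δ : ℝ) (hδ : 0 < δ) :
    ∃ (Q : Type) (_ : Finite Q) (r : ℂ → Q),
      ∀ a b, ‖a‖ ≤ K → ‖b‖ ≤ K → r a = r b → ‖a - b‖ ≤ δ := by
  classical
  obtain ⟨t, ht, hcov⟩ := Metric.totallyBounded_iff.1
    (isCompact_closedBall (0 : ℂ) K).totallyBounded (δ / 2) (by positivity)
  have hex : ∀ a : ℂ, ‖a‖ ≤ K → ∃ y : t, dist a y < δ / 2 := fun a ha => by
    have := hcov (by simpa using ha : a ∈ Metric.closedBall 0 K)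
    simpa using this
  have : Finite t := ht
  refine ⟨Option t, inferInstance,
    fun a => if h : ‖a‖ ≤ K then some (hex a h).choose else none, fun a b ha hb hab => ?_⟩
  simp only [ha, hb, dif_pos, Option.some.injEq] at hab
  have h1 := (hex a ha).choose_spec
  have h2 := (hex b hb).choose_spec
  rw [hab] at h1
  rw [← dist_eq_norm]
  linarith [dist_triangle_right a b ((hex b hb).choose : ℂ)]

variable {X : Type*}

/-- Enumerating by a total function on `ℕ` lets balls of different sizes be compared index by index,
without casts. -/
theorem Finset.exists_enumeration [Nonempty X] (s : Finset X) :
    ∃ p : ℕ → X, (∀ a b, a < s.card → b < s.card → p a = p b → a = b) ∧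
      ∀ x, x ∈ s ↔ ∃ a < s.card, p a = x := by
  classical
  refine ⟨fun a => if h : a < s.card then s.equivFin.symm ⟨a, h⟩ else Classical.arbitrary X,
    fun a b ha hb hab => ?_, fun x => ⟨fun hx => ?_, ?_⟩⟩
  · simp only [ha, hb, dif_pos] at hab
    simpa using s.equivFin.symm.injective (Subtype.ext hab)
  · refine ⟨s.equivFin ⟨x, hx⟩, (s.equivFin ⟨x, hx⟩).2, ?_⟩
    simp
  · rintro ⟨a, ha, rfl⟩
    simp only [ha, dif_pos]
    exact (s.equivFin.symm ⟨a, ha⟩).2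

/-- Finitely many operators on a space of bounded geometry look, up to `δ`, alike on the balls
around points of the same type, with finitely many types. Here `c i` is the point representing a
type, the `e i` with the same `c i` are the points of the ball around it, and `idx z x` is
the index of the point that corresponds to the point `x` of the ball around `z`. -/
theorem HasBoundedGeometry.exists_ball_types [MetricSpace X] (hX : HasBoundedGeometry X) (S : ℝ)
    (hS : 0 ≤ S) (F : Finset (BoundedOps X)) (δ : ℝ) (hδ : 0 < δ) :
    ∃ (n : ℕ) (c e : Fin n → X) (idx : X → X → Fin n),
      (∀ i j, c i = c j → e i = e j → i = j) ∧
      ∀ z x y, dist x z ≤ S → dist y z ≤ S →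
        c (idx z x) = c (idx z y) ∧ (idx z x = idx z y → x = y) ∧
        ∀ T ∈ F, ‖matrixEntry T x y - matrixEntry T (e (idx z x)) (e (idx z y))‖ ≤ δ := by
  classical
  rcases isEmpty_or_nonempty X with hE | hne
  · exact ⟨0, Fin.elim0, Fin.elim0, fun z => isEmptyElim z, fun i => i.elim0,
      fun z => isEmptyElim z⟩
  obtain ⟨N, hN⟩ := hX.exists_closedBall_finset S
  choose s hs hms using hN
  choose p hpinj hp using fun z => (s z).exists_enumeration
  obtain ⟨Q, _, r, hr⟩ := exists_finite_rounding (∑ T ∈ F, ‖T‖) δ hδ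
  have hK : ∀ T ∈ F, ∀ x y, ‖matrixEntry T x y‖ ≤ ∑ T ∈ F, ‖T‖ := fun T hT x y =>
    (norm_matrixEntry_le T x y).trans
      (Finset.single_le_sum (f := fun T : BoundedOps X => ‖T‖) (fun _ _ => norm_nonneg _) hT)
  -- The type of `z` is the size of its ball together with the rounded entries in the chosen
  -- enumeration. It takes finitely many values, so `rep` has finite range.
  let t : X → Fin (N + 1) × (F → Fin N → Fin N → Q) := fun z =>
    (⟨(s z).card, Nat.lt_succ_of_le (hs z)⟩, fun T a b => r (matrixEntry T.1 (p z a) (p z b)))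
  let rep : X → X := fun z => Function.invFun t (t z)
  have hrep : ∀ z, t (rep z) = t z := fun z => Function.invFun_eq ⟨z, rfl⟩
  have hcard : ∀ z, (s (rep z)).card = (s z).card := fun z =>
    congrArg (fun w => (w.1 : ℕ)) (hrep z)
  have hfin : (Set.range rep).Finite :=
    (Set.finite_range (Function.invFun t)).subset (by rintro _ ⟨z, rfl⟩; exact ⟨t z, rfl⟩)
  let I : Finset (X × X) := hfin.toFinset.biUnion fun w => (s w).image fun y => (w, y)
  have hI : ∀ z y, y ∈ s (rep z) → (rep z, y) ∈ I := fun z y hy =>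
    Finset.mem_biUnion.2 ⟨rep z, by simp, Finset.mem_image.2 ⟨y, hy, rfl⟩⟩
  let E := I.equivFin.symm
  have hidx : ∀ z x, ∃ i : Fin I.card, dist x z ≤ S → ∃ a < (s z).card, p z a = x ∧
      (E i : X × X) = (rep z, p (rep z) a) := fun z x => by
    by_cases hx : dist x z ≤ S
    · obtain ⟨a, ha, hax⟩ := (hp z x).1 ((hms z x).2 (by rwa [dist_comm]))
      have hm := hI z (p (rep z) a) ((hp (rep z) _).2 ⟨a, by rwa [hcard], rfl⟩)
      exact ⟨E.symm ⟨_, hm⟩, fun _ => ⟨a, ha, hax, by simp⟩⟩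
    -- A default for points outside the ball; the centre is available because `0 ≤ S`.
    · have hm := hI z (rep z) ((hms _ _).2 (by simpa using hS))
      exact ⟨E.symm ⟨_, hm⟩, fun h => absurd h hx⟩
  choose idx hidx using hidx
  refine ⟨I.card, fun i => (E i : X × X).1, fun i => (E i : X × X).2, idx, fun i j h1 h2 => ?_,
    fun z x y hx hy => ?_⟩
  · exact E.injective (Subtype.ext (Prod.ext h1 h2))
  obtain ⟨a, ha, hax, hai⟩ := hidx z x hx
  obtain ⟨b, hb, hby, hbi⟩ := hidx z y hy
  refine ⟨by dsimp only; rw [hai, hbi], fun h => ?_, fun T hT => ?_⟩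
  · rw [h, hbi] at hai
    have := hpinj (rep z) b a (by rwa [hcard]) (by rwa [hcard]) (Prod.ext_iff.1 hai).2
    rw [← hax, ← hby, this]
  · dsimp only
    rw [hai, hbi, ← hax, ← hby]
    refine hr _ _ (hK T hT _ _) (hK T hT _ _) ?_
    exact (congrFun (congrFun (congrFun (congrArg Prod.snd (hrep z)) ⟨T, hT⟩)
      ⟨a, ha.trans_le (hs z)⟩) ⟨b, hb.trans_le (hs z)⟩).symm

end BallTypes

/-! ### Compression to finitely many blocks -/

section Compression

open scoped InnerProductSpace ComplexOrder

/-- The representation of `M_n(ℂ)` on `ℂ^n`. -/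
noncomputable def CStarMatrix.toEuclidean (n : ℕ) : CStarMatrix (Fin n) (Fin n) ℂ →⋆ₐ[ℂ]
    (EuclideanSpace ℂ (Fin n) →L[ℂ] EuclideanSpace ℂ (Fin n)) :=
  ((CStarMatrix.ofMatrixStarAlgEquiv (n := Fin n) (A := ℂ)).symm.trans
    (Matrix.toEuclideanCLM (n := Fin n) (𝕜 := ℂ)) : _ ≃⋆ₐ[ℂ] _)

theorem CStarMatrix.toEuclidean_injective (n : ℕ) :
    Function.Injective (CStarMatrix.toEuclidean n) :=
  ((CStarMatrix.ofMatrixStarAlgEquiv (n := Fin n) (A := ℂ)).symm.trans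
    (Matrix.toEuclideanCLM (n := Fin n) (𝕜 := ℂ)) : _ ≃⋆ₐ[ℂ] _).injective

theorem CStarMatrix.inner_toEuclidean {n : ℕ} (M : CStarMatrix (Fin n) (Fin n) ℂ)
    (v w : EuclideanSpace ℂ (Fin n)) :
    ⟪v, CStarMatrix.toEuclidean n M w⟫_ℂ = ∑ i, ∑ j, star (v i) * w j * M i j := by
  have h : ∀ i, CStarMatrix.toEuclidean n M w i = ∑ j, M i j * w j := fun i => rfl
  simp only [PiLp.inner_apply, h, inner_sum]
  refine Finset.sum_congr rfl fun i _ => Finset.sum_congr rfl fun j _ => ?_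
  simp only [RCLike.inner_apply]
  change _ * (starRingEnd ℂ) _ = (starRingEnd ℂ) _ * _ * _
  ring

variable {X : Type*} [MetricSpace X] {n : ℕ}

open scoped Classical in
/-- The direct sum of the compressions of an operator to finitely many finite sets. -/
noncomputable def compression (c e : Fin n → X) :
    uniformRoeAlgebra X →ₗ[ℂ] CStarMatrix (Fin n) (Fin n) ℂ where
  toFun T := CStarMatrix.ofMatrix fun i j =>
    if c i = c j then matrixEntry (T : BoundedOps X) (e i) (e j) else 0
  map_add' T U := by
    ext i j
    change (if c i = c j then _ else (0 : ℂ)) = (if c i = c j then _ else (0 : ℂ)) +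
      (if c i = c j then _ else (0 : ℂ))
    split_ifs
    · exact matrixEntry_add _ _ _ _
    · simp
  map_smul' a T := by
    ext i j
    change (if c i = c j then _ else (0 : ℂ)) = a * (if c i = c j then _ else (0 : ℂ))
    split_ifs
    · exact matrixEntry_smul _ _ _ _
    · simp

open scoped Classical in
theorem compression_apply (c e : Fin n → X) (T : uniformRoeAlgebra X) (i j : Fin n) :
    compression c e T i j =
      if c i = c j then matrixEntry (T : BoundedOps X) (e i) (e j) else 0 := rfl

theorem compression_one {c e : Fin n → X} (h : ∀ i j, c i = c j → e i = e j → i = j) :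
    compression c e 1 = 1 := by
  classical
  ext i j
  rw [compression_apply, CStarMatrix.one_apply]
  change (if c i = c j then matrixEntry (1 : BoundedOps X) (e i) (e j) else 0) = _
  rw [matrixEntry_one]
  by_cases hij : i = j
  · simp [hij]
  · rw [if_neg hij]
    split_ifs with h1 h2
    · exact absurd (h i j h1 h2) hij
    · rfl
    · rfl

/-- The form splits over the blocks `w`, and on each it is the squared norm of the vector `∑ v i p •
a i δ_{e p}`, summed over `i` and the `p` with `c p = w`. -/
theorem compression_positiveType (c e : Fin n → X) (k : ℕ) (a : Fin k → uniformRoeAlgebra X)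
    (v : Fin k → EuclideanSpace ℂ (Fin n)) : ∃ r : ℝ, 0 ≤ r ∧
      ∑ i, ∑ j, ⟪v i, CStarMatrix.toEuclidean n (compression c e (star (a i) * a j)) (v j)⟫_ℂ
        = r := by
  classical
  let u : X → HilbertL2 X := fun w => ∑ i, ∑ p, if c p = w then
    v i p • (a i : BoundedOps X) (basisVec (e p)) else 0
  refine ⟨∑ w ∈ Finset.univ.image c, ‖u w‖ ^ 2, by positivity, ?_⟩
  have hu : ∀ w, ((‖u w‖ ^ 2 : ℝ) : ℂ) = ∑ i, ∑ j, ∑ p, ∑ q, if c p = w ∧ c q = w then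
      star (v i p) * v j q * matrixEntry (star (a i : BoundedOps X) * (a j : BoundedOps X))
        (e p) (e q) else 0 := by
    intro w
    have := inner_self_eq_norm_sq_to_K (𝕜 := ℂ) (u w)
    rw [Complex.ofReal_pow]
    refine this.symm.trans ?_
    simp only [u, sum_inner]
    simp only [inner_sum]
    refine Finset.sum_congr rfl fun i _ => ?_
    rw [Finset.sum_comm]
    refine Finset.sum_congr rfl fun j _ => Finset.sum_congr rfl fun p _ =>
      Finset.sum_congr rfl fun q _ => ?_
    by_cases hp : c p = w
    · by_cases hq : c q = w
      · simp only [hp, hq, if_true, and_self, inner_smul_left, inner_smul_right,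
          matrixEntry_star_mul]
        rw [← starRingEnd_apply]
        ring
      · simp [hq]
    · simp [hp]
  rw [Complex.ofReal_sum]
  simp only [hu]
  symm
  rw [Finset.sum_comm]
  refine Finset.sum_congr rfl fun i _ => ?_
  rw [Finset.sum_comm]
  refine Finset.sum_congr rfl fun j _ => ?_
  rw [Finset.sum_comm, CStarMatrix.inner_toEuclidean]
  refine Finset.sum_congr rfl fun p _ => ?_
  rw [Finset.sum_comm]
  refine Finset.sum_congr rfl fun q _ => ?_
  rw [Finset.sum_eq_single (c p) (fun w _ hw => by simp [hw.symm]) (by simp), compression_apply]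
  by_cases hpq : c p = c q
  · simp only [hpq, and_self, if_true]; rfl
  · simp [hpq, Ne.symm hpq]

end Compression

/-! ### Normalized indicator functions of finite sets -/

section Overlap

open scoped Classical in
theorem Finset.card_symmDiff {α : Type*} (s t : Finset α) :
    ((symmDiff s t).card : ℝ) = s.card + t.card - 2 * (s ∩ t).card := by
  have h1 : (symmDiff s t).card = (s \ t).card + (t \ s).card := by
    rw [symmDiff_def]
    exact Finset.card_union_of_disjoint disjoint_sdiff_sdiff
  have h2 : ((s ∩ t).card : ℝ) + (s \ t).card = s.card := by
    exact_mod_cast Finset.card_inter_add_card_sdiff s t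
  have h3 : ((s ∩ t).card : ℝ) + (t \ s).card = t.card := by
    rw [Finset.inter_comm]
    exact_mod_cast Finset.card_inter_add_card_sdiff t s
  rw [h1]
  push_cast
  linarith

open scoped Classical in
/-- The inner product of the normalized indicator functions of two finite sets. -/
noncomputable def overlap {α : Type*} (s t : Finset α) : ℝ :=
  (s ∩ t).card * ((√s.card)⁻¹ * (√t.card)⁻¹)

variable {α : Type*} {s t : Finset α}

theorem overlap_nonneg : 0 ≤ overlap s t := by
  unfold overlap
  positivity

theorem overlap_self (hs : s.Nonempty) : overlap s s = 1 := by
  classical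
  have h : (0 : ℝ) < s.card := by exact_mod_cast hs.card_pos
  rw [overlap, Finset.inter_self, ← mul_inv, Real.mul_self_sqrt h.le, mul_inv_cancel₀ h.ne']

theorem overlap_le_one (hs : s.Nonempty) (ht : t.Nonempty) : overlap s t ≤ 1 := by
  classical
  have h1 : (0 : ℝ) < s.card := by exact_mod_cast hs.card_pos
  have h2 : (0 : ℝ) < t.card := by exact_mod_cast ht.card_pos
  have h3 : ((s ∩ t).card : ℝ) ≤ √s.card * √t.card := by
    have h4 : ((s ∩ t).card : ℝ) ≤ s.card := by
      exact_mod_cast Finset.card_le_card Finset.inter_subset_left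
    have h5 : ((s ∩ t).card : ℝ) ≤ t.card := by
      exact_mod_cast Finset.card_le_card Finset.inter_subset_right
    rw [← Real.sqrt_mul h1.le]
    exact Real.le_sqrt_of_sq_le (by rw [sq]; gcongr)
  rw [overlap, ← mul_inv]
  exact mul_inv_le_one_of_le₀ h3 (by positivity)

-- Since `|s ∆ t| = |s| + |t| - 2 |s ∩ t|`, both `|s|` and `|t|` are at most `(1 + ε) |s ∩ t|`. So
-- the overlap is at least `1 / (1 + ε) ≥ 1 - ε`.
open scoped Classical in
theorem one_sub_overlap_le {ε : ℝ} (hε : 0 < ε) (hst : (s ∩ t).Nonempty)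
    (h : ((symmDiff s t).card : ℝ) / ((s ∩ t).card : ℝ) < ε) : 1 - overlap s t ≤ ε := by
  have h0 : (0 : ℝ) < (s ∩ t).card := by exact_mod_cast hst.card_pos
  rw [div_lt_iff₀ h0] at h
  rw [Finset.card_symmDiff] at h
  have hsi : ((s ∩ t).card : ℝ) ≤ s.card := by
    exact_mod_cast Finset.card_le_card Finset.inter_subset_left
  have hti : ((s ∩ t).card : ℝ) ≤ t.card := by
    exact_mod_cast Finset.card_le_card Finset.inter_subset_right
  have hs : (s.card : ℝ) ≤ (1 + ε) * (s ∩ t).card := by linarith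
  have ht : (t.card : ℝ) ≤ (1 + ε) * (s ∩ t).card := by linarith
  have hs0 : (0 : ℝ) < s.card := by
    exact_mod_cast (hst.mono Finset.inter_subset_left).card_pos
  have ht0 : (0 : ℝ) < t.card := by
    exact_mod_cast (hst.mono Finset.inter_subset_right).card_pos
  have hp : √s.card * √t.card ≤ (1 + ε) * (s ∩ t).card := by
    rw [← Real.sqrt_mul hs0.le]
    refine Real.sqrt_le_iff.2 ⟨by positivity, ?_⟩
    rw [sq]
    gcongr
  have h4 : 1 ≤ (1 + ε) * overlap s t := by
    rw [overlap, ← mul_inv, ← mul_assoc, ← div_eq_mul_inv, one_le_div (by positivity)]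
    exact hp
  nlinarith [overlap_nonneg (s := s) (t := t)]

end Overlap

/-! ### Gluing blocks to an operator -/

section Gluing

open scoped InnerProductSpace Topology ComplexOrder

variable {X : Type*} [MetricSpace X] {n : ℕ}

open scoped Classical in
/-- The entries of the operator glued together from copies of the matrix `M`, weighted by the
normalized indicator functions of the sets `A x`. -/
noncomputable def gluedEntry {X : Type*} (A : X → Finset (X × ℕ)) (idx : X → X → Fin n)
    (M : CStarMatrix (Fin n) (Fin n) ℂ) (x y : X) : ℂ :=
  ∑ z ∈ A x ∩ A y, (((√(A x).card)⁻¹ * (√(A y).card)⁻¹ : ℝ) : ℂ) * M (idx z.1 x) (idx z.1 y)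

/-- The weights are non-negative and sum to the overlap, which is at most `1`. -/
theorem norm_sum_inter_le {X : Type*} {A : X → Finset (X × ℕ)} (hA : ∀ x, (A x).Nonempty)
    [DecidableEq X]
    {x y : X} {c : ℝ} (hc : 0 ≤ c) {f : X × ℕ → ℂ} (hf : ∀ z ∈ A x ∩ A y, ‖f z‖ ≤ c) :
    ‖∑ z ∈ A x ∩ A y, (((√(A x).card)⁻¹ * (√(A y).card)⁻¹ : ℝ) : ℂ) * f z‖ ≤ c := by
  classical
  calc _ ≤ ∑ z ∈ A x ∩ A y, ((√(A x).card)⁻¹ * (√(A y).card)⁻¹) * c := by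
        refine (norm_sum_le _ _).trans (Finset.sum_le_sum fun z hz => ?_)
        rw [norm_mul, Complex.norm_real, Real.norm_of_nonneg (by positivity)]
        gcongr
        exact hf z hz
    _ = overlap (A x) (A y) * c := by
        rw [Finset.sum_const, nsmul_eq_mul, overlap, ← mul_assoc]
        congr!
    _ ≤ c := mul_le_of_le_one_left hc (overlap_le_one (hA x) (hA y))

theorem inter_eq_empty_of_lt_dist {A : X → Finset (X × ℕ)} {S : ℝ} [DecidableEq X]
    (hS : ∀ x, ∀ p ∈ A x, dist x p.1 ≤ S) {x y : X} (hxy : 2 * S < dist x y) :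
    A x ∩ A y = ∅ := by
  rw [Finset.eq_empty_iff_forall_notMem]
  intro z hz
  rw [Finset.mem_inter] at hz
  linarith [dist_triangle_right x y z.1, hS x z hz.1, hS y z hz.2]

/-- Gluing matrices to a finite propagation operator. -/
theorem exists_gluing (hX : HasBoundedGeometry X) {A : X → Finset (X × ℕ)}
    (hA : ∀ x, (A x).Nonempty) {S : ℝ} (hS0 : 0 ≤ S) (hS : ∀ x, ∀ p ∈ A x, dist x p.1 ≤ S)
    (idx : X → X → Fin n) :
    ∃ ψ : CStarMatrix (Fin n) (Fin n) ℂ →ₗ[ℂ] uniformRoeAlgebra X,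
      ∀ M x y, matrixEntry (ψ M : BoundedOps X) x y = gluedEntry A idx M x y := by
  classical
  have hex : ∀ M : CStarMatrix (Fin n) (Fin n) ℂ, ∃ T : uniformRoeAlgebra X, ∀ x y,
      matrixEntry (T : BoundedOps X) x y = gluedEntry A idx M x y := fun M => by
    obtain ⟨N, hN⟩ := hX.exists_operator (2 * S)
    have hzero : ∀ x y, 2 * S < dist x y → gluedEntry A idx M x y = 0 := fun x y hxy => by
      rw [gluedEntry]
      convert Finset.sum_empty
      exact inter_eq_empty_of_lt_dist hS hxy
    obtain ⟨T, -, hT⟩ := hN ‖M‖ (gluedEntry A idx M) (norm_nonneg _)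
      (fun x y => by
        rw [gluedEntry]
        convert norm_sum_inter_le hA (norm_nonneg M) fun z _ =>
          CStarMatrix.norm_entry_le_norm (M := M) (i := idx z.1 x) (j := idx z.1 y))
      hzero
    refine ⟨⟨T, (finitePropagationAlgebra X).le_topologicalClosure ?_⟩, hT⟩
    exact ⟨2 * S, by positivity, fun x y hxy => by rw [hT, hzero x y hxy]⟩
  choose ψ hψ using hex
  refine ⟨⟨⟨ψ, fun M M' => ?_⟩, fun a M => ?_⟩, hψ⟩
  · refine Subtype.ext (matrixEntry_ext fun x y => ?_)
    refine Eq.trans ?_ (matrixEntry_add _ _ x y).symm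
    simp only [hψ, gluedEntry, ← Finset.sum_add_distrib, CStarMatrix.add_apply, mul_add]
  · refine Subtype.ext (matrixEntry_ext fun x y => ?_)
    refine Eq.trans ?_ (matrixEntry_smul _ _ x y).symm
    simp only [hψ, gluedEntry, Finset.mul_sum, CStarMatrix.smul_apply, smul_eq_mul]
    exact Finset.sum_congr rfl fun z _ => by simp only [RingHom.id_apply]; ring

/-- Off the diagonal the entries vanish because `idx z` separates the points of the ball around `z`;
on the diagonal they are `overlap (A x) (A x) = 1`. -/
theorem gluing_one {A : X → Finset (X × ℕ)} (hA : ∀ x, (A x).Nonempty) {S : ℝ}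
    (hS : ∀ x, ∀ p ∈ A x, dist x p.1 ≤ S) {idx : X → X → Fin n}
    (hidx : ∀ z x y, dist x z ≤ S → dist y z ≤ S → idx z x = idx z y → x = y)
    {ψ : CStarMatrix (Fin n) (Fin n) ℂ →ₗ[ℂ] uniformRoeAlgebra X}
    (hψ : ∀ M x y, matrixEntry (ψ M : BoundedOps X) x y = gluedEntry A idx M x y) : ψ 1 = 1 := by
  classical
  refine Subtype.ext (matrixEntry_ext fun x y => ?_)
  rw [hψ]
  refine Eq.trans ?_ (matrixEntry_one x y).symm
  by_cases hxy : x = y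
  · subst hxy
    simp only [gluedEntry, CStarMatrix.one_apply, if_true, mul_one]
    rw [Finset.sum_const, nsmul_eq_mul]
    have := overlap_self (hA x)
    rw [overlap] at this
    rw [← Complex.ofReal_natCast, ← Complex.ofReal_mul, ← Complex.ofReal_one, ← this]
    congr!
  · rw [if_neg hxy, gluedEntry]
    refine Finset.sum_eq_zero fun z hz => ?_
    rw [Finset.mem_inter] at hz
    rw [CStarMatrix.one_apply_ne, mul_zero]
    exact fun h => hxy (hidx z.1 x y (hS x z hz.1) (hS y z hz.2) h)

theorem inner_sum_smul_basisVec {X : Type*} (T : BoundedOps X) (s : Finset X) (f g : X → ℂ) :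
    ⟪∑ x ∈ s, f x • basisVec x, T (∑ x ∈ s, g x • basisVec x)⟫_ℂ =
      ∑ x ∈ s, ∑ y ∈ s, star (f x) * g y * matrixEntry T x y := by
  simp only [map_sum, map_smul, sum_inner]
  refine Finset.sum_congr rfl fun x _ => ?_
  simp only [inner_sum]
  refine Finset.sum_congr rfl fun y _ => ?_
  rw [inner_smul_left, inner_smul_right, inner_basisVec_left, apply_basisVec, ← starRingEnd_apply]
  ring

-- Gluing is `M ↦ V* (1 ⊗ M) V` with `V δ_x = |A x|^(-1/2) ∑_{z ∈ A x} δ_z ⊗ e_{idx z.1 x}`. The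
-- factors are the coordinates of `(1 ⊗ a) V δ_x` and `(1 ⊗ b) V δ_y`, which vanish off `A x` and `A
-- y`; hence the freedom in `U`.
open scoped Classical in
theorem gluedEntry_star_mul {X : Type*} {A : X → Finset (X × ℕ)} {idx : X → X → Fin n}
    (a b : CStarMatrix (Fin n) (Fin n) ℂ) (x y : X) {U : Finset (X × ℕ)} (hU : A x ⊆ U) :
    gluedEntry A idx (star a * b) x y = ∑ z ∈ U, ∑ l,
      star (if z ∈ A x then (((√(A x).card)⁻¹ : ℝ) : ℂ) * a l (idx z.1 x) else 0) *
      (if z ∈ A y then (((√(A y).card)⁻¹ : ℝ) : ℂ) * b l (idx z.1 y) else 0) := by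
  rw [gluedEntry]
  refine Finset.sum_subset_zero_on_sdiff (Finset.inter_subset_left.trans hU) (fun z hz => ?_)
    fun z hz => ?_
  · rw [Finset.mem_sdiff, Finset.mem_inter, not_and_or] at hz
    refine Finset.sum_eq_zero fun l _ => ?_
    rcases hz.2 with h | h <;> simp [h]
  · rw [Finset.mem_inter] at hz
    simp only [hz.1, hz.2, if_true, CStarMatrix.mul_apply, CStarMatrix.star_apply, Finset.mul_sum]
    refine Finset.sum_congr rfl fun l _ => ?_
    simp only [← starRingEnd_apply, map_mul, Complex.conj_ofReal, Complex.ofReal_mul]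
    ring

theorem sum_star_mul_eq_norm_sq {P Q : Type*} (s : Finset P) (t : Finset Q) (f : P → Q → ℂ) :
    ∑ p ∈ s, ∑ p' ∈ s, ∑ q ∈ t, star (f p q) * f p' q =
      ((∑ q ∈ t, ‖∑ p ∈ s, f p q‖ ^ 2 : ℝ) : ℂ) := by
  rw [Finset.sum_comm_cycle, Complex.ofReal_sum]
  refine Finset.sum_congr rfl fun q _ => ?_
  rw [Complex.ofReal_pow, ← Complex.conj_mul', map_sum, Finset.sum_mul_sum]
  rfl

/-- On finitely supported vectors the form is a finite sum of squares. The general case follows by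
truncation, the non-negative reals being closed in `ℂ`. -/
theorem gluing_positiveType {A : X → Finset (X × ℕ)} {idx : X → X → Fin n}
    {ψ : CStarMatrix (Fin n) (Fin n) ℂ →ₗ[ℂ] uniformRoeAlgebra X}
    (hψ : ∀ M x y, matrixEntry (ψ M : BoundedOps X) x y = gluedEntry A idx M x y)
    (k : ℕ) (a : Fin k → CStarMatrix (Fin n) (Fin n) ℂ) (v : Fin k → HilbertL2 X) :
    ∃ r : ℝ, 0 ≤ r ∧
      ∑ i, ∑ j, ⟪v i, (ψ (star (a i) * a j) : BoundedOps X) (v j)⟫_ℂ = r := by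
  classical
  have hclosed : IsClosed {z : ℂ | ∃ r : ℝ, 0 ≤ r ∧ z = r} := by
    have : {z : ℂ | ∃ r : ℝ, 0 ≤ r ∧ z = r} = {z : ℂ | 0 ≤ z.re} ∩ {z : ℂ | z.im = 0} := by
      ext z
      constructor
      · rintro ⟨r, hr, rfl⟩
        simpa using hr
      · rintro ⟨h1, h2⟩
        exact ⟨z.re, h1, Complex.ext rfl (by simpa using h2)⟩
    rw [this]
    exact (isClosed_le continuous_const Complex.continuous_re).inter
      (isClosed_eq Complex.continuous_im continuous_const)
  have htend : Filter.Tendsto (fun s : Finset X => ∑ i, ∑ j,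
      ⟪∑ x ∈ s, v i x • basisVec x,
        (ψ (star (a i) * a j) : BoundedOps X) (∑ x ∈ s, v j x • basisVec x)⟫_ℂ) Filter.atTop
      (𝓝 (∑ i, ∑ j, ⟪v i, (ψ (star (a i) * a j) : BoundedOps X) (v j)⟫_ℂ)) := by
    refine tendsto_finsetSum _ fun i _ => tendsto_finsetSum _ fun j _ => ?_
    exact Filter.Tendsto.inner (hasSum_smul_basisVec (v i))
      (((ψ (star (a i) * a j) : BoundedOps X).continuous.tendsto _).comp
        (hasSum_smul_basisVec (v j)))
  refine hclosed.mem_of_tendsto htend (Filter.Eventually.of_forall fun s => ?_)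
  let f : Fin k × X → (X × ℕ) × Fin n → ℂ := fun p q => v p.1 p.2 *
    (if q.1 ∈ A p.2 then (((√(A p.2).card)⁻¹ : ℝ) : ℂ) * a p.1 q.2 (idx q.1.1 p.2) else 0)
  refine ⟨_, ?_, Eq.trans ?_
    (sum_star_mul_eq_norm_sq (Finset.univ ×ˢ s) (s.biUnion A ×ˢ Finset.univ) f)⟩
  · positivity
  simp only [inner_sum_smul_basisVec, hψ]
  rw [Finset.sum_product]
  refine Finset.sum_congr rfl fun i _ => ?_
  rw [Finset.sum_comm]
  refine Finset.sum_congr rfl fun x hx => ?_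
  rw [Finset.sum_product]
  refine Finset.sum_congr rfl fun j _ => Finset.sum_congr rfl fun y _ => ?_
  rw [gluedEntry_star_mul _ _ _ _ (Finset.subset_biUnion_of_mem A hx), Finset.sum_product,
    Finset.mul_sum]
  refine Finset.sum_congr rfl fun z _ => ?_
  rw [Finset.mul_sum]
  refine Finset.sum_congr rfl fun l _ => ?_
  simp only [f, star_mul']
  ring

end Gluing

/-! ### Property A implies nuclearity -/

section Nuclear

open scoped ComplexOrder

variable {X : Type*} [MetricSpace X]

/-- Both maps are contractive, so the approximation need only be checked on operators of finite
propagation. -/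
theorem CompletelyPositiveMap.norm_sub_comp_le {A B : Type*} [CStarAlgebra A] [PartialOrder A]
    [StarOrderedRing A] [CStarAlgebra B] [PartialOrder B] [StarOrderedRing B]
    (φ : CompletelyPositiveMap A B) (ψ : CompletelyPositiveMap B A) (hφ : φ 1 = 1) (hψ : ψ 1 = 1)
    (a b : A) : ‖a - ψ (φ a)‖ ≤ ‖b - ψ (φ b)‖ + 2 * ‖a - b‖ := by
  have h1 : ‖ψ (φ (b - a))‖ ≤ ‖a - b‖ := by
    rw [norm_sub_rev]
    exact (ψ.norm_apply_le hψ _).trans (φ.norm_apply_le hφ _)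
  have h2 : a - ψ (φ a) = (a - b) + (b - ψ (φ b)) + ψ (φ (b - a)) := by
    rw [map_sub, map_sub]; abel
  rw [h2]
  linarith [norm_add₃_le (a := a - b) (b := b - ψ (φ b)) (c := ψ (φ (b - a)))]

theorem uniformRoeAlgebra.exists_finitePropagation (T : uniformRoeAlgebra X) {ε : ℝ} (hε : 0 < ε) :
    ∃ T' : uniformRoeAlgebra X, HasFinitePropagation (T' : BoundedOps X) ∧ ‖T - T'‖ < ε := by
  have hT : (T : BoundedOps X) ∈ closure (finitePropagationAlgebra X : Set (BoundedOps X)) := T.2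
  obtain ⟨U, hU, hd⟩ := Metric.mem_closure_iff.1 hT ε hε
  refine ⟨⟨U, (finitePropagationAlgebra X).le_topologicalClosure hU⟩, hU, ?_⟩
  rwa [dist_eq_norm] at hd

/-- Gluing the compressions of `T` back together changes `T` only slightly, if `T` has propagation
at most `R` and the sets `A x` and `A y` nearly agree whenever `dist x y ≤ R`. -/
theorem norm_sub_gluing_compression_le {A : X → Finset (X × ℕ)} (hA : ∀ x, (A x).Nonempty)
    {S R ε δ : ℝ} (hS : ∀ x, ∀ p ∈ A x, dist x p.1 ≤ S) (hε : 0 ≤ ε) (hδ : 0 ≤ δ)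
    (hAR : ∀ x y, dist x y ≤ R → 1 - overlap (A x) (A y) ≤ ε) {N N' : ℕ}
    (hN : ∀ (c : ℝ) (m : X → X → ℂ), 0 ≤ c → (∀ x y, ‖m x y‖ ≤ c) →
      (∀ x y, R < dist x y → m x y = 0) →
      ∃ T : BoundedOps X, ‖T‖ ≤ c * N ∧ ∀ x y, matrixEntry T x y = m x y)
    (hN' : ∀ (c : ℝ) (m : X → X → ℂ), 0 ≤ c → (∀ x y, ‖m x y‖ ≤ c) →
      (∀ x y, 2 * S < dist x y → m x y = 0) →
      ∃ T : BoundedOps X, ‖T‖ ≤ c * N' ∧ ∀ x y, matrixEntry T x y = m x y)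
    {n : ℕ} {c e : Fin n → X} {idx : X → X → Fin n} {T : uniformRoeAlgebra X}
    (hT : ∀ x y, R < dist x y → matrixEntry (T : BoundedOps X) x y = 0)
    (hidx : ∀ z x y, dist x z ≤ S → dist y z ≤ S → c (idx z x) = c (idx z y) ∧
      ‖matrixEntry (T : BoundedOps X) x y -
        matrixEntry (T : BoundedOps X) (e (idx z x)) (e (idx z y))‖ ≤ δ)
    {ψ : CStarMatrix (Fin n) (Fin n) ℂ →ₗ[ℂ] uniformRoeAlgebra X}
    (hψ : ∀ M x y, matrixEntry (ψ M : BoundedOps X) x y = gluedEntry A idx M x y) :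
    ‖T - ψ (compression c e T)‖ ≤ ‖T‖ * ε * N + δ * N' := by
  classical
  -- `D` is the error of the Schur multiplier, supported where `dist x y ≤ R`.
  obtain ⟨D, hD, hDe⟩ := hN (‖T‖ * ε)
    (fun x y => matrixEntry (T : BoundedOps X) x y * ((1 - overlap (A x) (A y) : ℝ) : ℂ))
    (by positivity)
    (fun x y => by
      rcases le_or_gt (dist x y) R with h | h
      · rw [norm_mul, Complex.norm_real,
          Real.norm_of_nonneg (sub_nonneg.2 (overlap_le_one (hA x) (hA y)))]
        exact mul_le_mul (norm_matrixEntry_le _ _ _) (hAR x y h)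
          (sub_nonneg.2 (overlap_le_one (hA x) (hA y))) (norm_nonneg _)
      · rw [hT x y h]
        simp only [zero_mul, norm_zero]
        positivity)
    (fun x y h => by rw [hT x y h, zero_mul])
  -- `D'` is the error of replacing each ball by its representative, supported where `dist x y ≤ 2 *
  -- S`.
  obtain ⟨D', hD', hDe'⟩ := hN' δ
    (fun x y => ∑ z ∈ A x ∩ A y, (((√(A x).card)⁻¹ * (√(A y).card)⁻¹ : ℝ) : ℂ) *
      (matrixEntry (T : BoundedOps X) x y -
        matrixEntry (T : BoundedOps X) (e (idx z.1 x)) (e (idx z.1 y)))) hδ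
    (fun x y => norm_sum_inter_le hA hδ fun z hz => by
      rw [Finset.mem_inter] at hz
      exact (hidx z.1 x y (hS x z hz.1) (hS y z hz.2)).2)
    (fun x y h => by rw [inter_eq_empty_of_lt_dist hS h, Finset.sum_empty])
  have hsum : ((T - ψ (compression c e T) : uniformRoeAlgebra X) : BoundedOps X) = D + D' := by
    refine matrixEntry_ext fun x y => ?_
    refine (matrixEntry_sub _ _ x y).trans ?_
    rw [matrixEntry_add, hDe, hDe', hψ, gluedEntry]
    have h1 : ∀ z ∈ A x ∩ A y, compression c e T (idx z.1 x) (idx z.1 y) =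
        matrixEntry (T : BoundedOps X) (e (idx z.1 x)) (e (idx z.1 y)) := fun z hz => by
      rw [Finset.mem_inter] at hz
      rw [compression_apply, if_pos (hidx z.1 x y (hS x z hz.1) (hS y z hz.2)).1]
    have h2 : ((overlap (A x) (A y) : ℝ) : ℂ) =
        ∑ z ∈ A x ∩ A y, (((√(A x).card)⁻¹ * (√(A y).card)⁻¹ : ℝ) : ℂ) := by
      rw [Finset.sum_const, nsmul_eq_mul, overlap, ← Complex.ofReal_natCast, ← Complex.ofReal_mul]
      congr!
    simp only [mul_sub, Finset.sum_sub_distrib]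
    rw [← Finset.sum_mul, ← h2, Complex.ofReal_sub, Complex.ofReal_one]
    have h3 : ∑ z ∈ A x ∩ A y, (((√(A x).card)⁻¹ * (√(A y).card)⁻¹ : ℝ) : ℂ) *
        compression c e T (idx z.1 x) (idx z.1 y) = _ :=
      Finset.sum_congr rfl fun z hz => by rw [h1 z hz]
    have h4 : ∀ a b o t : ℂ, a = b → t - a = t * (1 - o) + (o * t - b) := by
      rintro a b o t rfl; ring
    apply h4
    convert h3
  calc ‖T - ψ (compression c e T)‖
      = ‖((T - ψ (compression c e T) : uniformRoeAlgebra X) : BoundedOps X)‖ := rfl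
    _ ≤ ‖D‖ + ‖D'‖ := by rw [hsum]; exact norm_add_le _ _
    _ ≤ _ := add_le_add hD hD'

theorem isNuclear_of_hasPropertyA (hX : HasBoundedGeometry X) (hA : HasPropertyA X) :
    IsNuclearCStarAlgebra (uniformRoeAlgebra X) := by
  classical
  intro F ε hε
  -- The error `ε / 4` of `g T` counts twice; the multiplier and the representatives cost another `ε
  -- / 4` each.
  choose g hgprop hg using fun T : uniformRoeAlgebra X =>
    uniformRoeAlgebra.exists_finitePropagation T (ε := ε / 4) (by positivity)
  choose r hr0 hr using hgprop
  obtain ⟨R, hR0, hR⟩ : ∃ R : ℝ, 0 < R ∧ ∀ T ∈ F, r T ≤ R :=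
    ⟨∑ T ∈ F, r T + 1, by have := Finset.sum_nonneg fun T (_ : T ∈ F) => hr0 T; linarith,
      fun T hT => by
        have := Finset.single_le_sum (f := r) (fun T _ => hr0 T) hT
        linarith⟩
  let K : ℝ := ∑ T ∈ F, ‖g T‖
  have hK : ∀ T ∈ F, ‖g T‖ ≤ K := fun T hT =>
    Finset.single_le_sum (f := fun T => ‖g T‖) (fun _ _ => norm_nonneg _) hT
  have hK0 : 0 ≤ K := Finset.sum_nonneg fun _ _ => norm_nonneg _
  obtain ⟨N, hN⟩ := hX.exists_operator R
  let η : ℝ := ε / (4 * (K * N + 1))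
  have hη : 0 < η := by positivity
  have hηK : K * η * N ≤ ε / 4 := by
    have : η * (K * N + 1) = ε / 4 := by simp only [η]; field_simp
    nlinarith
  obtain ⟨A, hAne, hAR, S₀, hS₀⟩ := hA R η hR0 hη
  obtain ⟨S, hS0, hS⟩ : ∃ S : ℝ, 0 ≤ S ∧ ∀ x, ∀ p ∈ A x, dist x p.1 ≤ S :=
    ⟨max S₀ 0, le_max_right _ _, fun x p hp => (hS₀ x p hp).trans (le_max_left _ _)⟩
  obtain ⟨N', hN'⟩ := hX.exists_operator (2 * S)
  let δ : ℝ := ε / (4 * (N' + 1))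
  have hδ : 0 < δ := by positivity
  have hδN : δ * N' ≤ ε / 4 := by
    have : δ * (N' + 1) = ε / 4 := by simp only [δ]; field_simp
    nlinarith
  obtain ⟨n, c, e, idx, hce, hidx⟩ :=
    hX.exists_ball_types S hS0 (F.image fun T => (g T : BoundedOps X)) δ hδ
  obtain ⟨ψ, hψ⟩ := exists_gluing hX hAne hS0 hS idx
  let Φ := CompletelyPositiveMap.ofPositiveType (CStarMatrix.toEuclidean n)
    (CStarMatrix.toEuclidean_injective n) (compression c e) (compression_positiveType c e)
  let Ψ := CompletelyPositiveMap.ofPositiveType (uniformRoeAlgebra X).subtype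
    Subtype.val_injective ψ (gluing_positiveType hψ)
  have hΦ1 : Φ 1 = 1 := compression_one hce
  have hΨ1 : Ψ 1 = 1 := gluing_one hAne hS (fun z x y hx hy => (hidx z x y hx hy).2.1) hψ
  refine ⟨n, Φ, Ψ, hΦ1, hΨ1, fun T hT => ?_⟩
  have h1 : ‖g T - Ψ (Φ (g T))‖ ≤ ‖g T‖ * η * N + δ * N' := by
    refine norm_sub_gluing_compression_le hAne hS hη.le hδ.le (fun x y hxy => ?_) hN hN'
      (fun x y hxy => hr T x y ((hR T hT).trans_lt hxy)) (fun z x y hx hy => ?_) hψ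
    · obtain ⟨h, h'⟩ := hAR x y hxy
      exact one_sub_overlap_le hη (by convert h) (by convert h')
    · exact ⟨(hidx z x y hx hy).1,
        (hidx z x y hx hy).2.2 _ (Finset.mem_image.2 ⟨T, hT, rfl⟩)⟩
  have h2 : ‖g T‖ * η * N ≤ ε / 4 :=
    (mul_le_mul_of_nonneg_right (mul_le_mul_of_nonneg_right (hK T hT) hη.le)
      (Nat.cast_nonneg _)).trans hηK
  have h3 := CompletelyPositiveMap.norm_sub_comp_le Φ Ψ hΦ1 hΨ1 T (g T)
  have h4 := hg T
  change ‖T - Ψ (Φ T)‖ < ε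
  linarith

end Nuclear

/-! ### Colourings and partial translations -/

section PartialTranslations

variable {X : Type*} [MetricSpace X]

/-- A space of bounded geometry can be coloured with finitely many colours in such a way that
distinct points at distance at most `P` have distinct colours. -/
theorem HasBoundedGeometry.exists_coloring (hX : HasBoundedGeometry X) (P : ℝ) :
    ∃ (N : ℕ) (c : X → ℕ), (∀ x, c x ≤ N) ∧ ∀ x y, dist x y ≤ P → c x = c y → x = y := by
  classical
  obtain ⟨_, _⟩ := exists_wellFoundedLT X
  obtain ⟨N, hN⟩ := hX.exists_closedBall_finset P
  choose s hs hms using hN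
  -- Greedy colouring along a well-order: the least colour not used by an earlier point within `P`.
  -- At most `N` colours are blocked, so some `k ≤ N` is free.
  let c : X → ℕ := IsWellFounded.fix (· < ·) fun x ih =>
    sInf {k | ∀ y (h : y < x), dist x y ≤ P → ih y h ≠ k}
  have hc : ∀ x, c x = sInf {k | ∀ y < x, dist x y ≤ P → c y ≠ k} := fun x =>
    IsWellFounded.fix_eq (· < ·) _ x
  have hfree : ∀ x, ∃ k ≤ N, ∀ y < x, dist x y ≤ P → c y ≠ k := fun x => by
    have hlt : ((s x).image c).card < (Finset.range (N + 1)).card := by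
      rw [Finset.card_range]
      exact Nat.lt_succ_of_le (Finset.card_image_le.trans (hs x))
    obtain ⟨k, hk, hk'⟩ := Finset.exists_mem_notMem_of_card_lt_card hlt
    exact ⟨k, Nat.lt_succ_iff.1 (Finset.mem_range.1 hk), fun y _ hy h =>
      hk' (Finset.mem_image.2 ⟨y, (hms x y).2 hy, h⟩)⟩
  have hspec : ∀ x, ∀ y < x, dist x y ≤ P → c y ≠ c x := fun x => by
    obtain ⟨k, -, hk⟩ := hfree x
    have := Nat.sInf_mem (s := {k | ∀ y < x, dist x y ≤ P → c y ≠ k}) ⟨k, hk⟩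
    rwa [← hc x] at this
  refine ⟨N, c, fun x => ?_, fun x y hxy hcxy => ?_⟩
  · obtain ⟨k, hkN, hk⟩ := hfree x
    rw [hc x]
    exact (Nat.sInf_le (s := {k | ∀ y < x, dist x y ≤ P → c y ≠ k}) hk).trans hkN
  · rcases lt_trichotomy x y with h | h | h
    · exact absurd hcxy (hspec y x h (by rwa [dist_comm]))
    · exact h
    · exact absurd hcxy.symm (hspec x y h hxy)

/-- The pairs of points at distance at most `R` are covered by the graphs of finitely many partial
translations. -/
theorem HasBoundedGeometry.exists_partialTranslations (hX : HasBoundedGeometry X) {R : ℝ}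
    (hR : 0 < R) : ∃ F : Finset (uniformRoeAlgebra X), (∀ v ∈ F, ‖v‖ ≤ 1) ∧
      ∀ x y, dist x y ≤ R → ∃ v ∈ F, matrixEntry (v : BoundedOps X) x y = 1 := by
  classical
  obtain ⟨N, c, hcN, hc⟩ := hX.exists_coloring (2 * R)
  have hex : ∀ p : ℕ × ℕ, ∃ v : uniformRoeAlgebra X, ‖v‖ ≤ 1 ∧ ∀ x y,
      matrixEntry (v : BoundedOps X) x y =
        if dist x y ≤ R ∧ c x = p.1 ∧ c y = p.2 then 1 else 0 := fun p => by
    have hsub : ∀ q : X → Prop, (∀ x y, q x → q y → x = y) →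
        ∃ s : Finset X, s.card ≤ 1 ∧ ∀ x, q x → x ∈ s := fun q hq => by
      by_cases h : ∃ x, q x
      · obtain ⟨x, hx⟩ := h
        exact ⟨{x}, by simp, fun y hy => by simpa using hq y x hy hx⟩
      · exact ⟨∅, by simp, fun y hy => absurd ⟨y, hy⟩ h⟩
    -- Two non-zero entries in a row or column would give points of one colour within `2 * R`. So
    -- the Schur test applies with `N = 1` and gives norm at most `1`.
    obtain ⟨T, hT, hTe⟩ := exists_operator_of_matrix
      (fun x y => if dist x y ≤ R ∧ c x = p.1 ∧ c y = p.2 then (1 : ℂ) else 0) 1 1 zero_le_one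
      (fun x y => by split_ifs <;> simp)
      (fun x => hsub _ fun y y' hy hy' => by
        simp only [ne_eq, ite_eq_right_iff, one_ne_zero, imp_false, not_not] at hy hy'
        refine hc y y' ?_ (hy.2.2.trans hy'.2.2.symm)
        linarith [dist_triangle_left y y' x])
      (fun y => hsub _ fun x x' hx hx' => by
        simp only [ne_eq, ite_eq_right_iff, one_ne_zero, imp_false, not_not] at hx hx'
        refine hc x x' ?_ (hx.2.1.trans hx'.2.1.symm)
        linarith [dist_triangle_right x x' y])
    refine ⟨⟨T, (finitePropagationAlgebra X).le_topologicalClosure ?_⟩, by simpa using hT, hTe⟩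
    refine ⟨R, hR.le, fun x y hxy => ?_⟩
    rw [hTe, if_neg fun h => absurd h.1 (not_le.2 hxy)]
  choose v hv hve using hex
  refine ⟨(Finset.range (N + 1) ×ˢ Finset.range (N + 1)).image v, ?_, fun x y hxy => ?_⟩
  · simp only [Finset.mem_image, forall_exists_index, and_imp]
    rintro _ p _ rfl
    exact hv p
  · refine ⟨v (c x, c y), Finset.mem_image_of_mem v ?_, by rw [hve]; simp [hxy]⟩
    simp [hcN]

end PartialTranslations

/-! ### Completely positive maps on matrix algebras -/

section Choi

open scoped ComplexOrder InnerProductSpace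

variable {B : Type*} [CStarAlgebra B] {n : ℕ}

/-- The map `M_n(ℂ) → B` determined by a matrix over `B`, as in Choi's theorem. -/
noncomputable def choiSum (b : Fin n → Fin n → B) (M : CStarMatrix (Fin n) (Fin n) ℂ) : B :=
  ∑ k, ∑ i, ∑ j, M i j • (star (b k i) * b k j)

/-- Choi's theorem: completely positive maps on matrix algebras have the form `choiSum b`. -/
theorem CompletelyPositiveMap.exists_choiSum [PartialOrder B] [StarOrderedRing B]
    (ψ : CompletelyPositiveMap (CStarMatrix (Fin n) (Fin n) ℂ) B) :
    ∃ b : Fin n → Fin n → B, ∀ M, ψ M = choiSum b M := by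
  classical
  let u : Fin n → Fin n → CStarMatrix (Fin n) (Fin n) ℂ := fun i j =>
    CStarMatrix.ofMatrix (Matrix.single i j 1)
  have hsum : ∀ M : CStarMatrix (Fin n) (Fin n) ℂ, M = ∑ i, ∑ j, M i j • u i j := fun M => by
    refine (Matrix.matrix_eq_sum_single (M : Matrix (Fin n) (Fin n) ℂ)).trans ?_
    refine Finset.sum_congr rfl fun i _ => Finset.sum_congr rfl fun j _ => ?_
    ext p q
    change Matrix.single i j (M i j) p q = M i j * Matrix.single i j 1 p q
    simp [Matrix.single_apply]
  rcases Nat.eq_zero_or_pos n with rfl | hn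
  · refine ⟨fun i => i.elim0, fun M => ?_⟩
    rw [hsum M]
    simp [choiSum]
  let k₀ : Fin n := ⟨0, hn⟩
  -- The matrix of matrix units is `star G * G`, as `star (u k₀ i) * u k₀ j = u i j`. Its image
  -- under `ψ` is therefore positive, and a factorization of that image supplies `b`.
  let G : CStarMatrix (Fin n) (Fin n) (CStarMatrix (Fin n) (Fin n) ℂ) :=
    CStarMatrix.ofMatrix fun k i => if k = k₀ then u k₀ i else 0
  have hG : ∀ i j, (star G * G) i j = u i j := fun i j => by
    rw [CStarMatrix.mul_apply, Finset.sum_eq_single k₀ (fun k _ hk => ?_) (by simp)]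
    · rw [CStarMatrix.star_apply]
      change star (if k₀ = k₀ then u k₀ i else 0) * (if k₀ = k₀ then u k₀ j else 0) = _
      rw [if_pos rfl, if_pos rfl]
      ext p q
      rw [CStarMatrix.mul_apply, Finset.sum_eq_single k₀ (fun l _ hl => ?_) (by simp)]
      · rw [CStarMatrix.star_apply]
        change star (Matrix.single k₀ i (1 : ℂ) k₀ p) * Matrix.single k₀ j (1 : ℂ) k₀ q =
          Matrix.single i j (1 : ℂ) p q
        by_cases hi : i = p <;> by_cases hj : j = q <;> simp [hi, hj]
      · change _ * Matrix.single k₀ j (1 : ℂ) l q = 0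
        simp [hl.symm]
    · change _ * (if k = k₀ then u k₀ j else 0) = 0
      rw [if_neg hk, mul_zero]
  obtain ⟨b, hb⟩ := exists_eq_star_mul_self_of_nonneg
    (ψ.map_cstarMatrix_nonneg' n (star G * G) (star_mul_self_nonneg G))
  have hu : ∀ i j, ψ (u i j) = ∑ k, star (b k i) * b k j := fun i j => by
    rw [← hG]
    have := congrArg (fun M : CStarMatrix (Fin n) (Fin n) B => M i j) hb
    refine this.trans ?_
    simp only [CStarMatrix.mul_apply, CStarMatrix.star_apply]
  refine ⟨fun k i => b k i, fun M => ?_⟩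
  conv_lhs => rw [hsum M]
  simp only [map_sum, map_smul, hu, choiSum, Finset.smul_sum]
  rw [Finset.sum_comm_cycle]

/-- Each of the `n³` terms moves by at most `K τ + τ (K + 1)`; `τ ≤ 1` serves to bound `‖b' k i‖` by
`K + 1`. -/
theorem norm_choiSum_sub_le {b b' : Fin n → Fin n → B} {K τ : ℝ} (hτ : τ ≤ 1)
    (hb : ∀ k i, ‖b k i‖ ≤ K) (hbb' : ∀ k i, ‖b k i - b' k i‖ ≤ τ)
    {M : CStarMatrix (Fin n) (Fin n) ℂ} (hM : ‖M‖ ≤ 1) :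
    ‖choiSum b M - choiSum b' M‖ ≤ n * (n * (n * (τ * (2 * K + 1)))) := by
  have hterm : ∀ k i j, ‖M i j • (star (b k i) * b k j) - M i j • (star (b' k i) * b' k j)‖ ≤
      τ * (2 * K + 1) := fun k i j => by
    have h1 : star (b k i) * b k j - star (b' k i) * b' k j =
        star (b k i) * (b k j - b' k j) + star (b k i - b' k i) * b' k j := by
      rw [star_sub]; noncomm_ring
    have hK : 0 ≤ K := (norm_nonneg _).trans (hb k i)
    have hτ0 : 0 ≤ τ := (norm_nonneg _).trans (hbb' k i)
    have h2 : ‖b' k j‖ ≤ K + 1 := by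
      have := norm_sub_norm_le (b' k j) (b k j)
      rw [norm_sub_rev] at this
      linarith [hb k j, hbb' k j]
    rw [← smul_sub, norm_smul, h1]
    have h3 : ‖M i j‖ ≤ 1 := CStarMatrix.norm_entry_le_norm.trans hM
    have h4 : ‖star (b k i) * (b k j - b' k j)‖ ≤ K * τ :=
      (norm_mul_le _ _).trans (mul_le_mul (by rw [norm_star]; exact hb k i) (hbb' k j)
        (norm_nonneg _) hK)
    have h5 : ‖star (b k i - b' k i) * b' k j‖ ≤ τ * (K + 1) :=
      (norm_mul_le _ _).trans (mul_le_mul (by rw [norm_star]; exact hbb' k i) h2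
        (norm_nonneg _) hτ0)
    calc _ ≤ 1 * (K * τ + τ * (K + 1)) := by
          gcongr
          exact (norm_add_le _ _).trans (add_le_add h4 h5)
      _ = τ * (2 * K + 1) := by ring
  have hsum : ∀ (C : ℝ) (f : Fin n → B), (∀ k, ‖f k‖ ≤ C) → ‖∑ k, f k‖ ≤ n * C := fun C f hf => by
    simpa using norm_sum_le_of_le Finset.univ fun k _ => hf k
  simp only [choiSum, ← Finset.sum_sub_distrib]
  exact hsum _ _ fun k => hsum _ _ fun i => hsum _ _ fun j => hterm k i j

end Choi

/-! ### From `ℓ¹`-functions to finite sets -/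

section FiniteSets

variable {X : Type*}

/-- The points of `X × ℕ` over `s` that lie under the graph of `f`. -/
def Finset.underGraph (s : Finset X) (f : X → ℕ) : Finset (X × ℕ) :=
  (s.sigma fun z => Finset.range (f z)).map (Equiv.sigmaEquivProd X ℕ).toEmbedding

theorem Finset.mem_underGraph {s : Finset X} {f : X → ℕ} {p : X × ℕ} :
    p ∈ s.underGraph f ↔ p.1 ∈ s ∧ p.2 < f p.1 := by
  simp [Finset.underGraph, Equiv.sigmaEquivProd]

theorem Finset.card_underGraph (s : Finset X) (f : X → ℕ) :
    (s.underGraph f).card = ∑ z ∈ s, f z := by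
  simp [Finset.underGraph]

theorem abs_natFloor_sub_natFloor_le {u v : ℝ} (hu : 0 ≤ u) (hv : 0 ≤ v) :
    |((⌊u⌋₊ : ℝ) - ⌊v⌋₊)| ≤ |u - v| + 1 := by
  have h1 := Nat.floor_le hu
  have h2 := Nat.floor_le hv
  have h3 := Nat.lt_floor_add_one u
  have h4 := Nat.lt_floor_add_one v
  rw [abs_le]
  constructor <;> linarith [le_abs_self (u - v), neg_abs_le (u - v)]

variable [MetricSpace X]

/-- Property A follows from the existence of almost invariant, uniformly finitely supported
families of non-negative functions. -/
theorem hasPropertyA_of_l1 (hX : HasBoundedGeometry X)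
    (h : ∀ R ε : ℝ, 0 < R → 0 < ε → ∃ (S : ℝ) (g : X → X → ℝ), (∀ x z, 0 ≤ g x z) ∧
      (∀ x z, S < dist x z → g x z = 0) ∧
      (∀ x (U : Finset X), (∀ z, dist x z ≤ S → z ∈ U) → 1 / 2 ≤ ∑ z ∈ U, g x z) ∧
      ∀ x y (U : Finset X), dist x y ≤ R → (∀ z, dist x z ≤ S → z ∈ U) →
        (∀ z, dist y z ≤ S → z ∈ U) → ∑ z ∈ U, |g x z - g y z| ≤ ε) :
    HasPropertyA X := by
  classical
  intro R ε hR hε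
  let ε' : ℝ := min ε 1
  have hε'0 : 0 < ε' := lt_min hε one_pos
  have hε'1 : ε' ≤ 1 := min_le_right _ _
  have hε' : ε' ≤ ε := min_le_left _ _
  obtain ⟨S, g, hg0, hgS, hg1, hgR⟩ := h R (ε' / 8) hR (by positivity)
  obtain ⟨N, hN⟩ := hX.exists_closedBall_finset S
  choose s hs hms using hN
  -- Scaling by `L` before taking floors makes the rounding error, at most `2 * N` over two balls,
  -- negligible even against `ε' * L`.
  let L : ℝ := 64 * (N + 1) / ε'
  have hL : ε' * L = 64 * (N + 1) := by simp only [L]; field_simp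
  have hL0 : 0 < L := by positivity
  have hLN : 64 * ((N : ℝ) + 1) ≤ L := by nlinarith
  let f : X → X → ℕ := fun x z => ⌊L * g x z⌋₊
  have hf0 : ∀ x z, z ∉ s x → f x z = 0 := fun x z hz => by
    have : S < dist x z := not_le.1 fun h => hz ((hms x z).2 h)
    simp [f, hgS x z this]
  have hcard : ∀ x, L / 2 - N ≤ ((s x).underGraph (f x)).card := fun x => by
    rw [Finset.card_underGraph]
    push_cast
    have h1 : ∑ z ∈ s x, (L * g x z - 1) ≤ ∑ z ∈ s x, (f x z : ℝ) :=
      Finset.sum_le_sum fun z _ => (Nat.sub_one_lt_floor _).le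
    rw [Finset.sum_sub_distrib, ← Finset.mul_sum, Finset.sum_const, nsmul_eq_mul, mul_one] at h1
    have h2 : L * (1 / 2) ≤ L * ∑ z ∈ s x, g x z :=
      mul_le_mul_of_nonneg_left (hg1 x (s x) fun z hz => (hms x z).2 hz) hL0.le
    have h3 : ((s x).card : ℝ) ≤ N := by exact_mod_cast hs x
    linarith
  refine ⟨fun x => (s x).underGraph (f x), fun x => ?_, fun x y hxy => ?_, S, fun x p hp => ?_⟩
  · rw [← Finset.card_pos]
    have : (0 : ℝ) < ((s x).underGraph (f x)).card :=
      lt_of_lt_of_le (by linarith [Nat.cast_nonneg (α := ℝ) N]) (hcard x)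
    exact_mod_cast this
  · let U := s x ∪ s y
    have hU : ∀ w, s w ⊆ U → (s w).underGraph (f w) = U.underGraph (f w) := fun w hw => by
      ext p
      rw [Finset.mem_underGraph, Finset.mem_underGraph]
      refine ⟨fun hp => ⟨hw hp.1, hp.2⟩, fun hp => ⟨?_, hp.2⟩⟩
      by_contra hps
      rw [hf0 w p.1 hps] at hp
      exact absurd hp.2 (Nat.not_lt_zero _)
    have hx := hU x Finset.subset_union_left
    have hy := hU y Finset.subset_union_right
    have hi : (s x).underGraph (f x) ∩ (s y).underGraph (f y) =
        U.underGraph fun z => min (f x z) (f y z) := by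
      rw [hx, hy]
      ext p
      simp only [Finset.mem_inter, Finset.mem_underGraph, lt_min_iff]
      tauto
    have hD : ((symmDiff ((s x).underGraph (f x)) ((s y).underGraph (f y))).card : ℝ) ≤
        L * (ε' / 8) + 2 * N := by
      have h1 : ((symmDiff ((s x).underGraph (f x)) ((s y).underGraph (f y))).card : ℝ) =
          ∑ z ∈ U, |(f x z : ℝ) - f y z| := by
        have h2 := Finset.card_symmDiff ((s x).underGraph (f x)) ((s y).underGraph (f y))
        refine Eq.trans (by congr!) (h2.trans ?_)
        have h3 : ((s x).underGraph (f x) ∩ (s y).underGraph (f y)).card =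
          ∑ z ∈ U, min (f x z) (f y z) := by rw [hi, Finset.card_underGraph]
        have h4 : (((s x).underGraph (f x) ∩ (s y).underGraph (f y)).card : ℝ) =
          ∑ z ∈ U, min (f x z : ℝ) (f y z) := by rw [h3]; push_cast; rfl
        have h5 : ∀ r : ℝ, r = ∑ z ∈ U, min (f x z : ℝ) (f y z) →
            (((s x).underGraph (f x)).card : ℝ) + ((s y).underGraph (f y)).card - 2 * r =
            ∑ z ∈ U, |(f x z : ℝ) - f y z| := by
          rintro _ rfl
          rw [hx, hy, Finset.card_underGraph, Finset.card_underGraph]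
          push_cast
          rw [Finset.mul_sum, ← Finset.sum_add_distrib, ← Finset.sum_sub_distrib]
          refine Finset.sum_congr rfl fun z _ => ?_
          rcases le_total (f x z : ℝ) (f y z) with h | h
          · rw [min_eq_left h, abs_of_nonpos (by linarith)]; ring
          · rw [min_eq_right h, abs_of_nonneg (by linarith)]; ring
        apply h5
        rw [← h4]
        congr!
      rw [h1]
      calc ∑ z ∈ U, |(f x z : ℝ) - f y z| ≤ ∑ z ∈ U, (L * |g x z - g y z| + 1) := by
            refine Finset.sum_le_sum fun z _ => ?_
            refine (abs_natFloor_sub_natFloor_le (mul_nonneg hL0.le (hg0 x z))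
              (mul_nonneg hL0.le (hg0 y z))).trans_eq ?_
            rw [← mul_sub, abs_mul, abs_of_pos hL0]
        _ = L * ∑ z ∈ U, |g x z - g y z| + U.card := by
            rw [Finset.sum_add_distrib, ← Finset.mul_sum]; simp
        _ ≤ L * (ε' / 8) + 2 * N := by
            have h3 : (U.card : ℝ) ≤ 2 * N := by
              have h4 : (U.card : ℝ) ≤ (s x).card + (s y).card := by
                exact_mod_cast Finset.card_union_le _ _
              have h5 : ((s x).card : ℝ) ≤ N := by exact_mod_cast hs x
              have h6 : ((s y).card : ℝ) ≤ N := by exact_mod_cast hs y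
              linarith
            have h4 := hgR x y U hxy
              (fun z hz => Finset.mem_union_left _ ((hms x z).2 hz))
              (fun z hz => Finset.mem_union_right _ ((hms y z).2 hz))
            exact add_le_add (mul_le_mul_of_nonneg_left h4 hL0.le) h3
    have hsd := Finset.card_symmDiff ((s x).underGraph (f x)) ((s y).underGraph (f y))
    have hN0 : (0 : ℝ) ≤ N := Nat.cast_nonneg N
    -- Here `d` and `i` stand for the sizes of the symmetric difference and the intersection. From
    -- `2 i = |A x| + |A y| - d` follows `i ≥ 7 L / 16 - 2 N`, and `ε' L = 64 (N + 1)` then gives `d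
    -- < ε' i`.
    have key : ∀ d i : ℝ, d ≤ L * (ε' / 8) + 2 * N →
        d = ((s x).underGraph (f x)).card + ((s y).underGraph (f y)).card - 2 * i →
        0 < i ∧ d / i < ε := by
      intro d i h1 h2
      have h3 := hcard x
      have h4 := hcard y
      have h5 : 28 * ((N : ℝ) + 1) - 2 * N ≤ i := by nlinarith
      have h6 : 7 * L / 16 - 2 * N ≤ i := by nlinarith
      have h7 : 0 < i := by linarith
      refine ⟨h7, lt_of_lt_of_le ?_ hε'⟩
      rw [div_lt_iff₀ h7]
      nlinarith
    obtain ⟨h1, h2⟩ := key _ _ (by convert hD) hsd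
    refine ⟨?_, by convert h2⟩
    rw [← Finset.card_pos]
    convert Nat.cast_pos.1 h1
  · exact (hms x p.1).1 (Finset.mem_underGraph.1 hp).1

end FiniteSets

/-! ### Nuclearity implies property A -/

section Kernel

open scoped ComplexOrder InnerProductSpace

/-- If the square roots of two non-negative functions are almost parallel, then the functions are
close in `ℓ¹`. -/
theorem sum_abs_sub_le_of_sum_sqrt {Z : Type*} (U : Finset Z) {g h : Z → ℝ} {η : ℝ}
    (hη0 : 0 ≤ η) (hη : η ≤ 1) (hg : ∀ z, 0 ≤ g z) (hh : ∀ z, 0 ≤ h z)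
    (hg1 : ∑ z ∈ U, g z ≤ 1 + η) (hh1 : ∑ z ∈ U, h z ≤ 1 + η)
    (hgh : 1 - 2 * η ≤ ∑ z ∈ U, √(g z) * √(h z)) :
    ∑ z ∈ U, |g z - h z| ≤ √(48 * η) := by
  -- Cauchy–Schwarz is applied to this factorization; the two sums of squares are at most `6 * η`
  -- and `8`.
  have e : ∀ z, |g z - h z| = |√(g z) - √(h z)| * (√(g z) + √(h z)) := fun z => by
    have h1 : g z - h z = (√(g z) - √(h z)) * (√(g z) + √(h z)) := by
      nlinarith [Real.sq_sqrt (hg z), Real.sq_sqrt (hh z)]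
    rw [h1, abs_mul, abs_of_nonneg (a := √(g z) + √(h z)) (by positivity)]
  have h1 : ∑ z ∈ U, |√(g z) - √(h z)| ^ 2 ≤ 6 * η := by
    have h2 : ∑ z ∈ U, |√(g z) - √(h z)| ^ 2 =
        ∑ z ∈ U, g z + ∑ z ∈ U, h z - 2 * ∑ z ∈ U, √(g z) * √(h z) := by
      rw [Finset.mul_sum, ← Finset.sum_add_distrib, ← Finset.sum_sub_distrib]
      refine Finset.sum_congr rfl fun z _ => ?_
      rw [sq_abs]
      nlinarith [Real.sq_sqrt (hg z), Real.sq_sqrt (hh z)]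
    linarith
  have h3 : ∑ z ∈ U, (√(g z) + √(h z)) ^ 2 ≤ 8 := by
    have h4 : ∑ z ∈ U, (√(g z) + √(h z)) ^ 2 ≤ ∑ z ∈ U, (2 * g z + 2 * h z) := by
      refine Finset.sum_le_sum fun z _ => ?_
      nlinarith [Real.sq_sqrt (hg z), Real.sq_sqrt (hh z), sq_nonneg (√(g z) - √(h z))]
    rw [Finset.sum_add_distrib, ← Finset.mul_sum, ← Finset.mul_sum] at h4
    linarith
  simp only [e]
  refine Real.le_sqrt_of_sq_le ((Finset.sum_mul_sq_le_sq_mul_sq _ _ _).trans ?_)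
  calc _ ≤ (6 * η) * 8 := by gcongr
    _ = 48 * η := by ring

variable {X : Type*} [MetricSpace X] {n : ℕ}

/-- The matrix entry as a linear functional on the uniform Roe algebra. -/
noncomputable def uniformRoeAlgebra.entry (x y : X) : uniformRoeAlgebra X →ₗ[ℂ] ℂ where
  toFun T := matrixEntry (T : BoundedOps X) x y
  map_add' _ _ := matrixEntry_add _ _ _ _
  map_smul' _ _ := matrixEntry_smul _ _ _ _

theorem uniformRoeAlgebra.norm_entry_le (T : uniformRoeAlgebra X) (x y : X) :
    ‖uniformRoeAlgebra.entry x y T‖ ≤ ‖T‖ := norm_matrixEntry_le _ _ _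

theorem uniformRoeAlgebra.entry_star_mul {T T' : uniformRoeAlgebra X} {x y : X} {U : Finset X}
    (hU : ∀ z ∉ U, entry z x T = 0) :
    entry x y (star T * T') = ∑ z ∈ U, star (entry z x T) * entry z y T' := by
  have h1 : entry x y (star T * T') =
      ⟪(T : BoundedOps X) (basisVec x), (T' : BoundedOps X) (basisVec y)⟫_ℂ :=
    matrixEntry_star_mul _ _ _ _
  rw [h1]
  refine (lp.hasSum_inner (𝕜 := ℂ) _ _).unique ?_
  have h2 : ∀ z, ⟪(T : BoundedOps X) (basisVec x) z, (T' : BoundedOps X) (basisVec y) z⟫_ℂ =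
      star (entry z x T) * entry z y T' := fun z => by
    rw [RCLike.inner_apply, mul_comm]
    rfl
  simp only [h2]
  exact hasSum_sum_of_ne_finset_zero fun z hz => by rw [hU z hz, star_zero, zero_mul]

/-- The column of the entries `(z, x)` of the operators `b k i`. -/
noncomputable def entryColumn (b : Fin n → Fin n → uniformRoeAlgebra X) (k : Fin n) (z x : X) :
    EuclideanSpace ℂ (Fin n) :=
  WithLp.toLp 2 fun i => uniformRoeAlgebra.entry z x (b k i)

/-- A Stinespring form: `M` acts between vectors attached to `x` and to `y`. Finite support of the
`x`-columns alone makes the sum finite. -/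
theorem entry_choiSum {b : Fin n → Fin n → uniformRoeAlgebra X} {x y : X} {U : Finset X}
    (hU : ∀ k i, ∀ z ∉ U, uniformRoeAlgebra.entry z x (b k i) = 0)
    (M : CStarMatrix (Fin n) (Fin n) ℂ) :
    uniformRoeAlgebra.entry x y (choiSum b M) = ∑ z ∈ U, ∑ k,
      ⟪entryColumn b k z x, CStarMatrix.toEuclidean n M (entryColumn b k z y)⟫_ℂ := by
  simp only [choiSum, map_sum, map_smul, smul_eq_mul, CStarMatrix.inner_toEuclidean]
  rw [Finset.sum_comm (s := U)]
  refine Finset.sum_congr rfl fun k _ => ?_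
  rw [Finset.sum_comm (s := U)]
  refine Finset.sum_congr rfl fun i _ => ?_
  rw [Finset.sum_comm (s := U)]
  refine Finset.sum_congr rfl fun j _ => ?_
  rw [uniformRoeAlgebra.entry_star_mul (hU k i), Finset.mul_sum]
  refine Finset.sum_congr rfl fun z _ => ?_
  rw [mul_comm]
  rfl

/-- The function `z ↦ ∑ |b k i (z, x)|²`. -/
noncomputable def columnWeight (b : Fin n → Fin n → uniformRoeAlgebra X) (x z : X) : ℝ :=
  ∑ k, ‖entryColumn b k z x‖ ^ 2

theorem columnWeight_nonneg (b : Fin n → Fin n → uniformRoeAlgebra X) (x z : X) :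
    0 ≤ columnWeight b x z := by
  unfold columnWeight
  positivity

theorem entry_choiSum_one {b : Fin n → Fin n → uniformRoeAlgebra X} {x : X} {U : Finset X}
    (hU : ∀ k i, ∀ z ∉ U, uniformRoeAlgebra.entry z x (b k i) = 0) :
    uniformRoeAlgebra.entry x x (choiSum b 1) = ((∑ z ∈ U, columnWeight b x z : ℝ) : ℂ) := by
  rw [entry_choiSum hU]
  push_cast
  refine Finset.sum_congr rfl fun z _ => ?_
  rw [columnWeight]
  push_cast
  refine Finset.sum_congr rfl fun k _ => ?_
  rw [map_one, one_apply_eq_self]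
  exact inner_self_eq_norm_sq_to_K _

/-- `M` acts as a contraction, so Cauchy–Schwarz applies first in `ℂ^n` and then over `k`. -/
theorem norm_entry_choiSum_le {b : Fin n → Fin n → uniformRoeAlgebra X} {x y : X} {U : Finset X}
    (hU : ∀ k i, ∀ z ∉ U, uniformRoeAlgebra.entry z x (b k i) = 0)
    {M : CStarMatrix (Fin n) (Fin n) ℂ} (hM : ‖M‖ ≤ 1) :
    ‖uniformRoeAlgebra.entry x y (choiSum b M)‖ ≤
      ∑ z ∈ U, √(columnWeight b x z) * √(columnWeight b y z) := by
  rw [entry_choiSum hU]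
  refine (norm_sum_le _ _).trans (Finset.sum_le_sum fun z _ => ?_)
  refine (norm_sum_le _ _).trans ?_
  refine le_trans (Finset.sum_le_sum fun k _ => ?_) (Real.sum_mul_le_sqrt_mul_sqrt _ _ _)
  refine (norm_inner_le_norm _ _).trans ?_
  gcongr
  refine (ContinuousLinearMap.le_opNorm _ _).trans ?_
  refine mul_le_of_le_one_left (norm_nonneg _) ?_
  exact (NonUnitalStarAlgHom.norm_apply_le (CStarMatrix.toEuclidean n) M).trans hM

theorem hasPropertyA_of_isNuclear (hX : HasBoundedGeometry X)
    (hnuc : IsNuclearCStarAlgebra (uniformRoeAlgebra X)) : HasPropertyA X := by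
  classical
  refine hasPropertyA_of_l1 hX fun R ε hR hε => ?_
  obtain ⟨F, hF1, hF⟩ := hX.exists_partialTranslations hR
  -- The bound `1 / 2` keeps the mass of the weights at least `1 / 2`; the other makes the
  -- `ℓ¹`-distance `√(48 * η)` at most `ε`.
  let η : ℝ := min (1 / 2) (ε ^ 2 / 48)
  have hη0 : 0 < η := by positivity
  have hη1 : η ≤ 1 / 2 := min_le_left _ _
  have hηε : √(48 * η) ≤ ε := by
    rw [Real.sqrt_le_left hε.le]
    have : η ≤ ε ^ 2 / 48 := min_le_right _ _
    linarith
  obtain ⟨n, φ, ψ, hφ1, hψ1, hφψ⟩ := hnuc F η hη0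
  obtain ⟨b, hb⟩ := ψ.exists_choiSum
  let K : ℝ := ∑ k, ∑ i, ‖b k i‖
  have hK0 : 0 ≤ K := by positivity
  have hK : ∀ k i, ‖b k i‖ ≤ K := fun k i =>
    (Finset.single_le_sum (f := fun i => ‖b k i‖) (fun _ _ => norm_nonneg _)
      (Finset.mem_univ i)).trans
    (Finset.single_le_sum (f := fun k => ∑ i, ‖b k i‖)
      (fun _ _ => Finset.sum_nonneg fun _ _ => norm_nonneg _) (Finset.mem_univ k))
  let C : ℝ := n * (n * (n * (2 * K + 1)))
  have hC : 0 ≤ C := by positivity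
  let τ : ℝ := min 1 (η / (C + 1))
  have hτ0 : 0 < τ := by positivity
  have hτη : n * (n * (n * (τ * (2 * K + 1)))) ≤ η := by
    have h1 : τ ≤ η / (C + 1) := min_le_right _ _
    rw [le_div_iff₀ (by positivity)] at h1
    have h2 : n * (n * (n * (τ * (2 * K + 1)))) = τ * C := by simp only [C]; ring
    linarith
  choose b' hb'prop hb' using fun k i =>
    uniformRoeAlgebra.exists_finitePropagation (b k i) hτ0
  choose r hr0 hr using hb'prop
  have happrox : ∀ M : CStarMatrix (Fin n) (Fin n) ℂ, ‖M‖ ≤ 1 → ‖ψ M - choiSum b' M‖ ≤ η :=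
    fun M hM => by
      rw [hb]
      exact (norm_choiSum_sub_le (min_le_left _ _) hK (fun k i => (hb' k i).le) hM).trans hτη
  let S : ℝ := ∑ k, ∑ i, r k i
  have hrS : ∀ k i, r k i ≤ S := fun k i =>
    (Finset.single_le_sum (f := fun i => r k i) (fun i _ => hr0 k i)
      (Finset.mem_univ i)).trans
    (Finset.single_le_sum (f := fun k => ∑ i, r k i)
      (fun k _ => Finset.sum_nonneg fun i _ => hr0 k i) (Finset.mem_univ k))
  have hzero : ∀ k i x z, S < dist x z → uniformRoeAlgebra.entry z x (b' k i) = 0 :=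
    fun k i x z hxz => hr k i z x ((hrS k i).trans_lt (by rwa [dist_comm]))
  have hU : ∀ x (U : Finset X), (∀ z, dist x z ≤ S → z ∈ U) →
      ∀ k i, ∀ z ∉ U, uniformRoeAlgebra.entry z x (b' k i) = 0 := fun x U hUx k i z hz =>
    hzero k i x z (not_le.1 fun h => hz (hUx z h))
  have hmass : ∀ x (U : Finset X), (∀ z, dist x z ≤ S → z ∈ U) →
      |1 - ∑ z ∈ U, columnWeight b' x z| ≤ η := fun x U hUx => by
    have h1 : ‖(1 : CStarMatrix (Fin n) (Fin n) ℂ)‖ ≤ 1 := by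
      nontriviality CStarMatrix (Fin n) (Fin n) ℂ
      rw [CStarRing.norm_one]
    have h2 := (uniformRoeAlgebra.norm_entry_le (ψ 1 - choiSum b' 1) x x).trans (happrox 1 h1)
    have h3 : uniformRoeAlgebra.entry x x (1 : uniformRoeAlgebra X) = 1 :=
      (matrixEntry_one x x).trans (if_pos rfl)
    rw [map_sub, hψ1, entry_choiSum_one (hU x U hUx), h3, ← Complex.ofReal_one,
      ← Complex.ofReal_sub, Complex.norm_real] at h2
    exact h2
  refine ⟨S, columnWeight b', columnWeight_nonneg b', fun x z hxz => ?_, fun x U hUx => ?_,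
    fun x y U hxy hUx hUy => ?_⟩
  · refine Finset.sum_eq_zero fun k _ => ?_
    have : entryColumn b' k z x = 0 := by
      ext i
      exact hzero k i x z hxz
    rw [this, norm_zero, sq, zero_mul]
  · linarith [(abs_le.1 (hmass x U hUx)).2]
  · refine le_trans (sum_abs_sub_le_of_sum_sqrt U hη0.le (by linarith) (columnWeight_nonneg b' x)
      (columnWeight_nonneg b' y) (by linarith [(abs_le.1 (hmass x U hUx)).1])
      (by linarith [(abs_le.1 (hmass y U hUy)).1]) ?_) hηε
    obtain ⟨v, hvF, hv⟩ := hF x y hxy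
    have hφv : ‖φ v‖ ≤ 1 := (φ.norm_apply_le hφ1 v).trans (hF1 v hvF)
    refine le_trans ?_ (norm_entry_choiSum_le (hU x U hUx) hφv)
    -- The entry `1` of `v` loses `η` on passing to `ψ (φ v)` and another `η` on replacing `b` by
    -- `b'`; hence the bound `1 - 2 * η`.
    have h1 := (uniformRoeAlgebra.norm_entry_le (ψ (φ v) - choiSum b' (φ v)) x y).trans
      (happrox _ hφv)
    have h2 := (uniformRoeAlgebra.norm_entry_le (v - ψ (φ v)) x y).trans (hφψ v hvF).le
    rw [map_sub] at h1 h2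
    have h3 : uniformRoeAlgebra.entry x y v = 1 := hv
    rw [h3] at h2
    have h4 := norm_sub_norm_le (1 : ℂ) (uniformRoeAlgebra.entry x y (ψ (φ v)))
    have h5 := norm_sub_norm_le (uniformRoeAlgebra.entry x y (ψ (φ v)))
      (uniformRoeAlgebra.entry x y (choiSum b' (φ v)))
    rw [norm_one] at h4
    linarith

end Kernel

theorem mainTheorem3 (X : Type*) [MetricSpace X] (hX : HasBoundedGeometry X) :
    IsNuclearCStarAlgebra (uniformRoeAlgebra X) ↔ HasPropertyA X := by
  exact ⟨hasPropertyA_of_isNuclear hX, isNuclear_of_hasPropertyA hX⟩
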